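/- Let $(M,\cdot,e,\langle\,,\,\rangle,E)$ be an $n$-dimensional semisimple Frobenius manifold of charge $D$ (a complex manifold with a holomorphic family of Frobenius algebra structures on its tangent spaces such that the metric is flat, $\nabla e=0$, $\nabla c$ is symmetric for $c(X,Y,Z)=\langle X\cdot Y,Z\rangle$, and $E$ satisfies $[E,X\cdot Y]-[E,X]\cdot Y-X\cdot[E,Y]=X\cdot Y$ and $E\langle X,Y\rangle-\langle[E,X],Y\rangle-\langle X,[E,Y]\rangle=(2-D)\langle X,Y\rangle$). Let $B\subset M$ be the domain of a flat chart $v=(v^1,\dots,v^n)$ with $e=\partial/\partial v^\iota$ and $E=\sum_\beta\big((1-\tfrac D2-\mu_\beta)v^\beta+r^\beta\big)\,\partial/\partial v^\beta$ for constants $\mu_\beta,r^\beta$, put $\eta_{\alpha\beta}=\langle\partial/\partial v^\alpha,\partial/\partial v^\beta\rangle$, $\partial_\alpha=\partial/\partial v^\alpha$, $\mu=\mathrm{diag}(\mu_1,\dots,\mu_n)$, and write $c^\gamma_{\alpha\beta}$ for the structure functions of the product. Let $R$ be a constant matrix and $(\theta_{\alpha,m})_{m\ge0}$ a calibration on $B$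 associated to $(\mu,R)$: $R=\sum_{s\ge1}R_s$, $z^\mu Rz^{-\mu}=\sum_{s\ge1}R_sz^s$, $\eta^{-1}R_s^T\eta=(-1)^{s+1}R_s$, and the $\theta_{\alpha,m}$ are holomorphic with $\theta_{\alpha,0}=\sum_\rho\eta_{\alpha\rho}v^\rho$, $\partial_\alpha\partial_\beta\theta_{\gamma,m+1}=\sum_\sigma c_{\alpha\beta}^\sigma\,\partial_\sigma\theta_{\gamma,m}$, $\langle\nabla\theta_\alpha(z),\nabla\theta_\beta(-z)\rangle=\eta_{\alpha\beta}$ for $\theta_\alpha(z)=\sum_m\theta_{\alpha,m}z^m$, $\partial_\iota\theta_{\alpha,m+1}=\theta_{\alpha,m}$, and $E(\partial_\beta\theta_{\alpha,m})=(m+\mu_\alpha+\mu_\beta)\,\partial_\beta\theta_{\alpha,m}+\sum_\gamma\sum_{k=1}^m(R_k)^\gamma_\alpha\,\partial_\beta\theta_{\gamma,m-k}$. Define $\Omega_{\alpha,m_1;\beta,m_2}$ by $\sum_{m_1,m_2\ge0}\Omega_{\alpha,m_1;\beta,m_2}z^{m_1}w^{m_2}=\dfrac{\langle\nabla\theta_\alpha(z),\nabla\theta_\beta(w)\rangle-\eta_{\alpha\beta}}{z+w}$.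 Assume that the eigenvalues $u_1,\dots,u_n$ of $E\,\cdot$ (chosen as holomorphic functions on $B$) are pairwise distinct at every point of $B$; these are the canonical coordinates. Choose holomorphic square roots $s_i=\sqrt{\eta_{ii}}$ of $\eta_{ii}=\langle\partial/\partial u_i,\partial/\partial u_i\rangle$ on $B$, put $f_i=s_i^{-1}\,\partial/\partial u_i$, and define $\Psi=(\psi_{i\alpha})$ by $\partial/\partial v^\alpha=\sum_i\psi_{i\alpha}f_i$, $V=\Psi\mu\Psi^{-1}$, $U=\mathrm{diag}(u_1,\dots,u_n)$, where $\mu$ is the matrix of $\tfrac{2-D}2\,\mathrm{id}-\nabla E$ in the flat coordinates. The isomonodromic system is $$\frac{\partial Y}{\partial u_i}=(zE_i+V_i)Y,\qquad \frac{dY}{dz}=\Big(U+\frac Vz\Big)Y,\qquad (E_i)_{ab}=\delta_{ia}\delta_{ib},\quad V_i=\mathrm{ad}_U^{-1}[E_i,V].$$ Its formal solution at $z=\infty$ is $Y_{\rm formal}=\Phi e^{zU}$, $\Phi=\sum_{k\ge0}\Phi_k(u)z^{-k}$, $\Phi_0=I$, $\Phi(-z)^T\Phi(z)=I$. A line $\ell$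 through $0$ with oriented direction $e^{i\phi}$, $\phi\in[0,2\pi)$, is admissible at $p\in B$ if $\mathrm{Re}\,z(u_i(p)-u_j(p))\ne0$ for $i\ne j$, $z\in\ell\setminus0$. For small $\varepsilon>0$ let $Y_{\rm right}$, $Y_{\rm left}$ be the fundamental matrix solutions of $dY/dz=(U+V/z)Y$ at $p$, analytic in $\phi-\pi-\varepsilon<\arg z<\phi+\varepsilon$ and $\phi-\varepsilon<\arg z<\phi+\pi+\varepsilon$ respectively, that are asymptotic to $Y_{\rm formal}$ there as $|z|\to\infty$. In the sector $\phi-\varepsilon<\arg z<\phi+\varepsilon$, the Stokes matrix $S$ is defined by $Y_{\rm left}=Y_{\rm right}S$ and the central connection matrix $C$ by $Y_{\rm right}=Y_0C$, with $Y_0=\Psi\,\Theta\,z^\mu z^R$, $\Theta^\alpha_\beta=\sum_\gamma\eta^{\alpha\gamma}\,\partial_\gamma\theta_\beta(z)$. Fix $\kappa\in\{1,\dots,n\}$ such that multiplication by $\partial/\partial v^\kappa$ is invertible on $B$. Let $S_\kappa(M)$ be $B$ with the same product, $e$ and $E$, with the metric $\langle x,y\rangle^\wedge=\langle\partial_\kappa\cdot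 x,\partial_\kappa\cdot y\rangle$ and charge $-2\mu_\kappa$, with the flat coordinates $\hat v^\alpha=\sum_\beta\eta^{\alpha\beta}\,\Omega_{\beta,0;\kappa,0}$ and the calibration $\hat\theta_{\alpha,m}=\Omega_{\alpha,m;\kappa,0}$; use for it the same $(\mu,R)$, the same $u_i$, and the square roots $\sqrt{\hat\eta_{ii}}:=\psi_{i\kappa}$. Hats denote the objects constructed as above from $S_\kappa(M)$ with these choices. Then, on $B$, $d\hat v$ is invertible and $\hat\eta_{\alpha\beta}=\eta_{\alpha\beta}$ in the coordinates $\hat v$; the $u_i$ are canonical coordinates of $S_\kappa(M)$ and the $\psi_{i\kappa}$ are holomorphic square roots of $\langle\partial/\partial u_i,\partial/\partial u_i\rangle^\wedge$. Moreover: 1. $\hat\Psi=\Psi$ and $\hat V=V$ on $B$. 2. The formal solutions at $z=\infty$ agree, $\hat\Phi=\Phi$ on $B$, i.e. $\hat Y_{\rm formal}=Y_{\rm formal}$. 3. For every $p\in B$ and every oriented line admissible at $p$, used for both $M$ and $S_\kappa(M)$, the Stokes matrix of $S_\kappa(M)$ coincides with that of $M$, and the central connection matrix of $S_\kappa(M)$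 coincides with that of $M$. In 2 and 3, "agree" and "coincide" mean that a series $\Phi$, respectively a matrix, has the defining property for $M$ if and only if it has it for $S_\kappa(M)$, and that any two objects with the defining properties, one for $M$ and one for $S_\kappa(M)$, are equal. -/

import Mathlib

open scoped Manifold ContDiff Topology

/-! Frobenius manifolds, Legendre-type transformations and monodromy data.

Complex manifolds are manifolds of class `ω` over `ℂ`, modelled on `Fin n → ℂ`. -/

noncomputable section

/-- A Frobenius structure, without its axioms: a multiplication and a bilinear form on each tangent
space, the unit vector field `e`, the Euler vector field `E` and the charge `D`. -/
structure FrobeniusData (n : ℕ) (M : Type*) [TopologicalSpace M] [ChartedSpace (Fin n → ℂ) M] where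
  mul : ∀ p : M, TangentSpace 𝓘(ℂ, Fin n → ℂ) p →ₗ[ℂ] TangentSpace 𝓘(ℂ, Fin n → ℂ) p →ₗ[ℂ]
    TangentSpace 𝓘(ℂ, Fin n → ℂ) p
  unit : ∀ p : M, TangentSpace 𝓘(ℂ, Fin n → ℂ) p
  metric : ∀ p : M, TangentSpace 𝓘(ℂ, Fin n → ℂ) p →ₗ[ℂ] TangentSpace 𝓘(ℂ, Fin n → ℂ) p →ₗ[ℂ] ℂ
  euler : ∀ p : M, TangentSpace 𝓘(ℂ, Fin n → ℂ) p
  charge : ℂ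

section Coordinates

variable {n : ℕ} {M : Type*} [TopologicalSpace M] [ChartedSpace (Fin n → ℂ) M]

/-- The derivative `X(f)` of a function along a tangent vector. -/
def dirDeriv (f : M → ℂ) (p : M) (X : TangentSpace 𝓘(ℂ, Fin n → ℂ) p) : ℂ :=
  mfderiv 𝓘(ℂ, Fin n → ℂ) 𝓘(ℂ, ℂ) f p X

/-- The differential at `p` of an `n`-tuple of functions `w = (w¹, …, wⁿ)`. -/
def dCoord (w : M → Fin n → ℂ) (p : M) : TangentSpace 𝓘(ℂ, Fin n → ℂ) p →L[ℂ] (Fin n → ℂ) :=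
  mfderiv 𝓘(ℂ, Fin n → ℂ) 𝓘(ℂ, Fin n → ℂ) w p

/-- The coordinate vector `∂/∂w^α` at `p`, for local coordinates `w`: the vector on which
`dw^α` is `1` and the other `dw^β` are `0`. -/
def coordVec (w : M → Fin n → ℂ) (p : M) (α : Fin n) : TangentSpace 𝓘(ℂ, Fin n → ℂ) p :=
  (dCoord w p).inverse (Pi.single α 1)

/-- The partial derivative `∂f/∂w^α`. -/
def coordDeriv (w : M → Fin n → ℂ) (α : Fin n) (f : M → ℂ) (p : M) : ℂ :=
  dirDeriv f p (coordVec w p α)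

/-- `X` is a holomorphic vector field on `U`. -/
def IsHolomorphicField [IsManifold 𝓘(ℂ, Fin n → ℂ) ω M] (U : Set M)
    (X : ∀ p : M, TangentSpace 𝓘(ℂ, Fin n → ℂ) p) : Prop :=
  ContMDiffOn 𝓘(ℂ, Fin n → ℂ) 𝓘(ℂ, Fin n → ℂ).tangent ω
    (fun p => (⟨p, X p⟩ : TangentBundle 𝓘(ℂ, Fin n → ℂ) M)) U

/-- `f` is a holomorphic function on `U`. -/
def IsHolomorphicOn (n : ℕ) {M : Type*} [TopologicalSpace M] [ChartedSpace (Fin n → ℂ) M]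
    (U : Set M) (f : M → ℂ) : Prop :=
  ContMDiffOn 𝓘(ℂ, Fin n → ℂ) 𝓘(ℂ, ℂ) ω f U

end Coordinates

namespace FrobeniusData

variable {n : ℕ} {M : Type*} [TopologicalSpace M] [ChartedSpace (Fin n → ℂ) M]

/-- The Gram matrix `η_{αβ} = ⟨∂/∂w^α, ∂/∂w^β⟩`. -/
def gram (F : FrobeniusData n M) (w : M → Fin n → ℂ) (p : M) : Matrix (Fin n) (Fin n) ℂ :=
  Matrix.of fun α β => F.metric p (coordVec w p α) (coordVec w p β)

/-- `c_{αβγ} = ⟨∂_α · ∂_β, ∂_γ⟩`. -/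
def cLow (F : FrobeniusData n M) (w : M → Fin n → ℂ) (α β γ : Fin n) (p : M) : ℂ :=
  F.metric p (F.mul p (coordVec w p α) (coordVec w p β)) (coordVec w p γ)

/-- The structure functions `c^γ_{αβ}`: `∂_α · ∂_β = ∑_γ c^γ_{αβ} ∂_γ`. -/
def cUp (F : FrobeniusData n M) (w : M → Fin n → ℂ) (γ α β : Fin n) (p : M) : ℂ :=
  dCoord w p (F.mul p (coordVec w p α) (coordVec w p β)) γ

/-- The components `E^α` of the Euler vector field: `E = ∑_α E^α ∂/∂w^α`. -/
def eulerComp (F : FrobeniusData n M) (w : M → Fin n → ℂ) (α : Fin n) (p : M) : ℂ :=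
  dCoord w p (F.euler p) α

/-- The components `e^α` of the unit vector field. -/
def unitComp (F : FrobeniusData n M) (w : M → Fin n → ℂ) (α : Fin n) (p : M) : ℂ :=
  dCoord w p (F.unit p) α

/-- A flat coordinate chart: a holomorphic chart in which the metric is constant. -/
def IsFlatChart (F : FrobeniusData n M) (φ : OpenPartialHomeomorph M (Fin n → ℂ)) : Prop :=
  φ ∈ IsManifold.maximalAtlas 𝓘(ℂ, Fin n → ℂ) ω M ∧
    ∀ p ∈ φ.source, ∀ q ∈ φ.source, F.gram φ p = F.gram φ q

/-- The axioms of a Frobenius manifold of charge `D = F.charge`. The covariant derivative `∇` of the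
Levi-Civita connection is the componentwise derivative in flat charts. -/
structure IsFrobenius [IsManifold 𝓘(ℂ, Fin n → ℂ) ω M] (F : FrobeniusData n M) : Prop where
  mul_comm : ∀ (p : M) (x y : TangentSpace 𝓘(ℂ, Fin n → ℂ) p), F.mul p x y = F.mul p y x
  mul_assoc : ∀ (p : M) (x y z : TangentSpace 𝓘(ℂ, Fin n → ℂ) p),
    F.mul p (F.mul p x y) z = F.mul p x (F.mul p y z)
  unit_mul : ∀ (p : M) (x : TangentSpace 𝓘(ℂ, Fin n → ℂ) p), F.mul p (F.unit p) x = x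
  metric_symm : ∀ (p : M) (x y : TangentSpace 𝓘(ℂ, Fin n → ℂ) p), F.metric p x y = F.metric p y x
  metric_nondegenerate : ∀ (p : M) (x : TangentSpace 𝓘(ℂ, Fin n → ℂ) p),
    (∀ y, F.metric p x y = 0) → x = 0
  metric_mul : ∀ (p : M) (x y z : TangentSpace 𝓘(ℂ, Fin n → ℂ) p),
    F.metric p (F.mul p x y) z = F.metric p x (F.mul p y z)
  /-- the Frobenius algebras depend holomorphically on the point -/
  holomorphic_unit : IsHolomorphicField Set.univ F.unit
  holomorphic_mul : ∀ U : Set M, IsOpen U → ∀ X Y : ∀ p : M, TangentSpace 𝓘(ℂ, Fin n → ℂ) p,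
    IsHolomorphicField U X → IsHolomorphicField U Y →
      IsHolomorphicField U (fun p => F.mul p (X p) (Y p))
  holomorphic_metric : ∀ U : Set M, IsOpen U → ∀ X Y : ∀ p : M, TangentSpace 𝓘(ℂ, Fin n → ℂ) p,
    IsHolomorphicField U X → IsHolomorphicField U Y →
      IsHolomorphicOn n U (fun p => F.metric p (X p) (Y p))
  /-- axiom A1: the metric is flat, and `∇ e = 0` -/
  flat : ∀ p : M, ∃ φ : OpenPartialHomeomorph M (Fin n → ℂ), p ∈ φ.source ∧ F.IsFlatChart φ
  unit_flat : ∀ φ : OpenPartialHomeomorph M (Fin n → ℂ), F.IsFlatChart φ → ∀ p ∈ φ.source,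
    ∀ α β : Fin n, coordDeriv φ β (F.unitComp φ α) p = 0
  /-- axiom A2: the tensor `∇ c` is symmetric -/
  nabla_c_symm : ∀ φ : OpenPartialHomeomorph M (Fin n → ℂ), F.IsFlatChart φ → ∀ p ∈ φ.source,
    ∀ α β γ δ : Fin n, coordDeriv φ δ (F.cLow φ α β γ) p = coordDeriv φ α (F.cLow φ δ β γ) p
  /-- axiom A3: the Euler vector field -/
  holomorphic_euler : IsHolomorphicField Set.univ F.euler
  euler_mul : ∀ U : Set M, IsOpen U → ∀ X Y : ∀ p : M, TangentSpace 𝓘(ℂ, Fin n → ℂ) p,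
    IsHolomorphicField U X → IsHolomorphicField U Y → ∀ p ∈ U,
      VectorField.mlieBracket 𝓘(ℂ, Fin n → ℂ) F.euler (fun q => F.mul q (X q) (Y q)) p
        - F.mul p (VectorField.mlieBracket 𝓘(ℂ, Fin n → ℂ) F.euler X p) (Y p)
        - F.mul p (X p) (VectorField.mlieBracket 𝓘(ℂ, Fin n → ℂ) F.euler Y p)
      = F.mul p (X p) (Y p)
  euler_metric : ∀ U : Set M, IsOpen U → ∀ X Y : ∀ p : M, TangentSpace 𝓘(ℂ, Fin n → ℂ) p,
    IsHolomorphicField U X → IsHolomorphicField U Y → ∀ p ∈ U,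
      dirDeriv (fun q => F.metric q (X q) (Y q)) p (F.euler p)
        - F.metric p (VectorField.mlieBracket 𝓘(ℂ, Fin n → ℂ) F.euler X p) (Y p)
        - F.metric p (X p) (VectorField.mlieBracket 𝓘(ℂ, Fin n → ℂ) F.euler Y p)
      = (2 - F.charge) * F.metric p (X p) (Y p)

/-- `p` is a semisimple point: the algebra `T_p M` has no nilpotents. -/
def IsSemisimpleAt (F : FrobeniusData n M) (p : M) : Prop :=
  ¬ ∃ a : TangentSpace 𝓘(ℂ, Fin n → ℂ) p, a ≠ 0 ∧ ∃ m : ℕ, (⇑(F.mul p a))^[m] (F.unit p) = 0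

/-- Generic points are semisimple. -/
def IsSemisimple (F : FrobeniusData n M) : Prop := Dense {p : M | F.IsSemisimpleAt p}

/-- A flat chart `φ` with coordinates `v`, in which `e = ∂/∂v^ι` and
`E = ∑_β ((1 - D/2 - μ_β) v^β + r^β) ∂/∂v^β` with constants `μ_β`, `r^β`. -/
def IsAdaptedFlatChart (F : FrobeniusData n M) (φ : OpenPartialHomeomorph M (Fin n → ℂ))
    (ι : Fin n) (μ r : Fin n → ℂ) : Prop :=
  F.IsFlatChart φ ∧ ∀ p ∈ φ.source, F.unit p = coordVec φ p ι ∧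
    F.euler p = ∑ β, ((1 - F.charge / 2 - μ β) * φ p β + r β) • coordVec φ p β

/-- The pairing `⟨∇f, ∇g⟩ = ∑ η^{ρσ} ∂_ρ f ∂_σ g` of two gradients. -/
def gradPair (F : FrobeniusData n M) (w : M → Fin n → ℂ) (f g : M → ℂ) (p : M) : ℂ :=
  ∑ ρ, ∑ σ, (F.gram w p)⁻¹ ρ σ * coordDeriv w ρ f p * coordDeriv w σ g p

end FrobeniusData

/-- The part `R_s` of `R`, with `z^μ R z^{-μ} = ∑_s R_s z^s`: the entries with `μ_α - μ_β = s`. -/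
def gradedPart {n : ℕ} (μ : Fin n → ℂ) (R : Matrix (Fin n) (Fin n) ℂ) (s : ℕ) :
    Matrix (Fin n) (Fin n) ℂ :=
  open Classical in Matrix.of fun α β => if μ α - μ β = s then R α β else 0

/-- The conditions on monodromy data `(μ, R)` at `z = 0`: `R = ∑_{s ≥ 1} R_s` with
`z^μ R z^{-μ} = ∑_{s ≥ 1} R_s z^s`, and `η⁻¹ R_sᵀ η = (-1)^{s+1} R_s`. -/
def IsZeroMonodromyPair {n : ℕ} (η : Matrix (Fin n) (Fin n) ℂ) (μ : Fin n → ℂ)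
    (R : Matrix (Fin n) (Fin n) ℂ) : Prop :=
  (∀ α β, R α β ≠ 0 → ∃ s : ℕ, 1 ≤ s ∧ μ α - μ β = s) ∧
    ∀ s : ℕ, 1 ≤ s →
      η⁻¹ * (gradedPart μ R s).transpose * η = (-1 : ℂ) ^ (s + 1) • gradedPart μ R s

namespace FrobeniusData

variable {n : ℕ} {M : Type*} [TopologicalSpace M] [ChartedSpace (Fin n → ℂ) M]

/-- The functions `θ_{α,m} = θ α m` are a calibration on `B` associated to `(μ, R)`, with respect to
flat coordinates `w` with `e = ∂/∂w^ι`. -/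
structure IsCalibration (F : FrobeniusData n M) (B : Set M) (w : M → Fin n → ℂ) (ι : Fin n)
    (μ : Fin n → ℂ) (R : Matrix (Fin n) (Fin n) ℂ) (θ : Fin n → ℕ → M → ℂ) : Prop where
  monodromy : ∀ p ∈ B, IsZeroMonodromyPair (F.gram w p) μ R
  holomorphic : ∀ α m, IsHolomorphicOn n B (θ α m)
  zero : ∀ α, ∀ p ∈ B, θ α 0 p = ∑ ρ, F.gram w p α ρ * w p ρ
  succ : ∀ (γ : Fin n) (m : ℕ) (α β : Fin n), ∀ p ∈ B,
    coordDeriv w α (coordDeriv w β (θ γ (m + 1))) p =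
      ∑ σ, F.cUp w σ α β p * coordDeriv w σ (θ γ m) p
  /-- `⟨∇θ_α(z), ∇θ_β(-z)⟩ = η_{αβ}`, coefficient by coefficient in `z` -/
  orthogonal : ∀ (α β : Fin n) (k : ℕ), ∀ p ∈ B,
    ∑ j ∈ Finset.range (k + 1), (-1 : ℂ) ^ j * F.gradPair w (θ α (k - j)) (θ β j) p =
      if k = 0 then F.gram w p α β else 0
  unit_deriv : ∀ (α : Fin n) (m : ℕ), ∀ p ∈ B, coordDeriv w ι (θ α (m + 1)) p = θ α m p
  homogeneous : ∀ (α β : Fin n) (m : ℕ), ∀ p ∈ B,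
    dirDeriv (coordDeriv w β (θ α m)) p (F.euler p) =
      (m + μ α + μ β) * coordDeriv w β (θ α m) p +
        ∑ γ, ∑ k ∈ Finset.Icc 1 m, gradedPart μ R k γ α * coordDeriv w β (θ γ (m - k)) p

/-- The genus zero two-point functions `Ω_{α,m₁;β,m₂}`, i.e. the coefficients of
`(⟨∇θ_α(z), ∇θ_β(w)⟩ - η_{αβ}) / (z + w)`; the sum is the result of the division. -/
def twoPoint (F : FrobeniusData n M) (w : M → Fin n → ℂ) (θ : Fin n → ℕ → M → ℂ)
    (α : Fin n) (m₁ : ℕ) (β : Fin n) (m₂ : ℕ) (p : M) : ℂ :=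
  ∑ m ∈ Finset.range (m₂ + 1),
    (-1 : ℂ) ^ m * F.gradPair w (θ α (m₁ + m + 1)) (θ β (m₂ - m)) p

/-! ### The Legendre-type transformation -/

/-- `S_κ(M)`: the same multiplication, unit and Euler vector field, the metric
`⟨x, y⟩^ = ⟨∂/∂v^κ · x, ∂/∂v^κ · y⟩`, and the charge `-2 μ_κ`. It is only meaningful on the domain
of the coordinates `v`. -/
def legendre (F : FrobeniusData n M) (v : M → Fin n → ℂ) (μ : Fin n → ℂ) (κ : Fin n) :
    FrobeniusData n M where
  mul := F.mul
  unit := F.unit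
  metric p := (F.metric p).compl₁₂ (F.mul p (coordVec v p κ)) (F.mul p (coordVec v p κ))
  euler := F.euler
  charge := -2 * μ κ

/-- The flat coordinates `v̂^α = ∑_β η^{αβ} v̂_β`, `v̂_β = Ω_{β,0;κ,0}`, of `S_κ(M)`. -/
def legendreCoord (F : FrobeniusData n M) (v : M → Fin n → ℂ) (θ : Fin n → ℕ → M → ℂ) (κ : Fin n) :
    M → Fin n → ℂ :=
  fun p α => ∑ β, (F.gram v p)⁻¹ α β * F.twoPoint v θ β 0 κ 0 p

/-- The calibration `θ̂_{α,m} = Ω_{α,m;κ,0}` of `S_κ(M)`. -/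
def legendreCalibration (F : FrobeniusData n M) (v : M → Fin n → ℂ) (θ : Fin n → ℕ → M → ℂ)
    (κ : Fin n) : Fin n → ℕ → M → ℂ :=
  fun α m p => F.twoPoint v θ α m κ 0 p

/-! ### Canonical coordinates and the isomonodromic system -/

/-- The matrix `𝓤^α_β = ∑_ρ E^ρ c^α_{ρβ}` of the multiplication by `E`. -/
def eulerMul (F : FrobeniusData n M) (w : M → Fin n → ℂ) (p : M) : Matrix (Fin n) (Fin n) ℂ :=
  Matrix.of fun α β => ∑ ρ, F.eulerComp w ρ p * F.cUp w α ρ β p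

/-- The matrix of `𝓥 = (2 - D)/2 id - ∇E` in flat coordinates `w`. -/
def gradingMatrix (F : FrobeniusData n M) (w : M → Fin n → ℂ) (p : M) :
    Matrix (Fin n) (Fin n) ℂ :=
  ((2 - F.charge) / 2) • (1 : Matrix (Fin n) (Fin n) ℂ)
    - Matrix.of fun α β => coordDeriv w β (F.eulerComp w α) p

/-- `u₁, …, uₙ` are canonical coordinates on `B` (`w` are flat coordinates): the functions `u_i` are
holomorphic, they are the eigenvalues of `𝓤`, and these are pairwise distinct at every point of `B`.
(That `u` is then a local coordinate system, with `∂/∂u_i · ∂/∂u_j = δ_{ij} ∂/∂u_j`, is not part of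
the definition.) -/
structure IsCanonicalCoordinates (F : FrobeniusData n M) (B : Set M) (w u : M → Fin n → ℂ) :
    Prop where
  holomorphic : ∀ i, IsHolomorphicOn n B (fun p => u p i)
  eigenvalues : ∀ p ∈ B, ∀ z : ℂ,
    (z • (1 : Matrix (Fin n) (Fin n) ℂ) - F.eulerMul w p).det = ∏ i, (z - u p i)
  distinct : ∀ p ∈ B, Function.Injective (u p)

/-- `s_i` is a (holomorphic) choice on `B` of the square roots of `η_{ii} = ⟨∂/∂u_i, ∂/∂u_i⟩`. -/
def IsRootChoice (F : FrobeniusData n M) (B : Set M) (u s : M → Fin n → ℂ) : Prop :=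
  (∀ i, IsHolomorphicOn n B (fun p => s p i)) ∧
    ∀ p ∈ B, ∀ i, s p i ^ 2 = F.metric p (coordVec u p i) (coordVec u p i)

end FrobeniusData

section Transition

variable {n : ℕ} {M : Type*} [TopologicalSpace M] [ChartedSpace (Fin n → ℂ) M]

/-- The orthonormal frame `f_i = (1/√η_{ii}) ∂/∂u_i`, with `s_i` for `√η_{ii}`. -/
def normFrame (u s : M → Fin n → ℂ) (p : M) (i : Fin n) : TangentSpace 𝓘(ℂ, Fin n → ℂ) p :=
  (s p i)⁻¹ • coordVec u p i

/-- The transition matrix `Ψ = (ψ_{iα})` from the frame `(f_i)` to the frame `(∂/∂w^α)`, that is,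
`ψ_{iα} = √η_{ii} ∂u_i/∂w^α`; see `coordVec_eq_sum_normFrame`. -/
def transitionMatrix (w u s : M → Fin n → ℂ) (p : M) : Matrix (Fin n) (Fin n) ℂ :=
  Matrix.of fun i α => s p i * dCoord u p (coordVec w p α) i

/-- The defining property `∂/∂w^α = ∑_i ψ_{iα} f_i` of the transition matrix. -/
theorem coordVec_eq_sum_normFrame (w u s : M → Fin n → ℂ) (p : M)
    (hu : (dCoord u p).IsInvertible) (hs : ∀ i, s p i ≠ 0) (α : Fin n) :
    coordVec w p α = ∑ i, transitionMatrix w u s p i α • normFrame u s p i := by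
  obtain ⟨T, hT⟩ := hu
  apply T.injective
  have hc : ∀ i, T (coordVec u p i) = Pi.single i 1 := by
    intro i
    simp [coordVec, ← hT]
  ext j
  simp only [map_sum, map_smul, normFrame, hc, transitionMatrix, Matrix.of_apply, ← hT,
    Finset.sum_apply, Pi.smul_apply, smul_eq_mul, ContinuousLinearEquiv.coe_coe]
  rw [Finset.sum_eq_single j]
  · simp only [Pi.single_eq_same, mul_one]
    field_simp [hs j]
  · intro i _ hij
    simp [Pi.single_eq_of_ne hij.symm]
  · simp

end Transition

/-- `Φ = ∑_k Φ_k(u) z^{-k}` is a formal series on `B` such that `Φ_0 = I`, `Φ(-z)ᵀ Φ(z) = I`, and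
`Y = Φ e^{zU}`, `U = diag(u)`, is a formal solution of
`∂Y/∂u_i = (z E_i + V_i) Y` and `dY/dz = (U + V/z) Y`, with `V_i = ad_U⁻¹ [E_i, V]`.
Both equations are written coefficient by coefficient, after cancelling `e^{zU}`. -/
structure IsFormalSolution {n : ℕ} {M : Type*} [TopologicalSpace M] [ChartedSpace (Fin n → ℂ) M]
    (B : Set M) (u : M → Fin n → ℂ) (V : M → Matrix (Fin n) (Fin n) ℂ)
    (Φ : ℕ → M → Matrix (Fin n) (Fin n) ℂ) : Prop where
  holomorphic : ∀ k a b, IsHolomorphicOn n B (fun p => Φ k p a b)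
  zero : ∀ p ∈ B, Φ 0 p = 1
  orthogonal : ∀ k : ℕ, ∀ p ∈ B,
    ∑ j ∈ Finset.range (k + 1), (-1 : ℂ) ^ j • ((Φ j p).transpose * Φ (k - j) p) =
      if k = 0 then 1 else 0
  /-- the coefficient of `z^{-k}` of `∂Φ/∂u_i + z Φ E_i = (z E_i + V_i) Φ` -/
  eq_u : ∀ (i : Fin n) (k : ℕ), ∀ p ∈ B,
    (Matrix.of fun a b => coordDeriv u i (fun q => Φ k q a b) p)
        + Φ (k + 1) p * Matrix.single i i (1 : ℂ) =
      Matrix.single i i (1 : ℂ) * Φ (k + 1) p +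
        (Matrix.of fun a b => if a = b then 0 else
          (Matrix.single i i (1 : ℂ) * V p - V p * Matrix.single i i (1 : ℂ)) a b / (u p a - u p b)) * Φ k p
  /-- the coefficient of `z^{-k-1}` of `dΦ/dz + Φ U = (U + V/z) Φ` -/
  eq_z : ∀ k : ℕ, ∀ p ∈ B,
    -(k : ℂ) • Φ k p + Φ (k + 1) p * Matrix.diagonal (u p) =
      Matrix.diagonal (u p) * Φ (k + 1) p + V p * Φ k p

/-- The line through `0` with oriented direction `e^{iφ}` is admissible for `u₁, …, uₙ`. -/
def IsAdmissible {n : ℕ} (u : Fin n → ℂ) (φ : ℝ) : Prop :=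
  ∀ i j, i ≠ j → ∀ t : ℝ, t ≠ 0 → (t * Complex.exp (φ * Complex.I) * (u i - u j)).re ≠ 0

/-- The sector `a < arg z < b`. -/
def sector (a b : ℝ) : Set ℂ :=
  {z | ∃ r t : ℝ, 0 < r ∧ a < t ∧ t < b ∧ z = r * Complex.exp (t * Complex.I)}

/-- `Y` is a fundamental matrix solution of `dY/dz = (U + V/z) Y`, `U = diag(u)`, on the sector `P`,
with `Y ~ (∑_k Φ_k z^{-k}) e^{zU}` as `|z| → ∞` in `P`. -/
structure IsSectorialSolution {n : ℕ} (u : Fin n → ℂ) (V : Matrix (Fin n) (Fin n) ℂ)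
    (Φ : ℕ → Matrix (Fin n) (Fin n) ℂ) (P : Set ℂ) (Y : ℂ → Matrix (Fin n) (Fin n) ℂ) : Prop where
  analytic : ∀ a b, AnalyticOnNhd ℂ (fun z => Y z a b) P
  eq_z : ∀ z ∈ P, ∀ a b,
    HasDerivAt (fun z => Y z a b) (((Matrix.diagonal u + z⁻¹ • V) * Y z) a b) z
  nonsingular : ∀ z ∈ P, (Y z).det ≠ 0
  asymptotic : ∀ (N : ℕ) (a b : Fin n),
    (fun z => (Y z * Matrix.diagonal fun i => Complex.exp (-(z * u i))) a b
        - ∑ k ∈ Finset.range N, Φ k a b * z⁻¹ ^ k)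
      =O[Bornology.cobounded ℂ ⊓ Filter.principal P] (fun z => z⁻¹ ^ N)

namespace FrobeniusData

variable {n : ℕ} {M : Type*} [TopologicalSpace M] [ChartedSpace (Fin n → ℂ) M]

/-- `V = Ψ μ Ψ⁻¹`, where `μ` is the matrix of `𝓥` in the flat coordinates `w`. -/
def vMatrix (F : FrobeniusData n M) (w u s : M → Fin n → ℂ) (p : M) : Matrix (Fin n) (Fin n) ℂ :=
  transitionMatrix w u s p * F.gradingMatrix w p * (transitionMatrix w u s p)⁻¹

/-- `Θ(w; z)^α_β = ∑_γ η^{αγ} ∂θ_β(w; z)/∂w^γ` with `θ_β(w; z) = ∑_m θ_{β,m} z^m`. -/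
def thetaMatrix (F : FrobeniusData n M) (w : M → Fin n → ℂ) (θ : Fin n → ℕ → M → ℂ) (p : M)
    (z : ℂ) : Matrix (Fin n) (Fin n) ℂ :=
  Matrix.of fun α β => ∑ γ, (F.gram w p)⁻¹ α γ * ∑' m : ℕ, coordDeriv w γ (θ β m) p * z ^ m

/-- `Y_0(u; z) = Ψ Θ(w; z) z^μ z^R` at `z = e^ζ`, with the branch `log z = ζ`. -/
def solutionAtZero (F : FrobeniusData n M) (w u s : M → Fin n → ℂ) (θ : Fin n → ℕ → M → ℂ)
    (μ : Fin n → ℂ) (R : Matrix (Fin n) (Fin n) ℂ) (p : M) (ζ : ℂ) : Matrix (Fin n) (Fin n) ℂ :=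
  transitionMatrix w u s p * F.thetaMatrix w θ p (Complex.exp ζ)
    * (Matrix.diagonal fun α => Complex.exp (ζ * μ α)) * NormedSpace.exp (ζ • R)

/-- `S` is the Stokes matrix, at the point `p`, subjected to the oriented line of angle `φ`:
`Y_left = Y_right S` in the sector around the positive half-line. -/
def IsStokesMatrix (F : FrobeniusData n M) (B : Set M) (w u s : M → Fin n → ℂ) (φ : ℝ) (p : M)
    (S : Matrix (Fin n) (Fin n) ℂ) : Prop :=
  ∃ Φ : ℕ → M → Matrix (Fin n) (Fin n) ℂ, IsFormalSolution B u (F.vMatrix w u s) Φ ∧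
    ∃ ε : ℝ, 0 < ε ∧ ε < Real.pi / 2 ∧ ∃ Yright Yleft : ℂ → Matrix (Fin n) (Fin n) ℂ,
      IsSectorialSolution (u p) (F.vMatrix w u s p) (fun k => Φ k p)
        (sector (φ - Real.pi - ε) (φ + ε)) Yright ∧
      IsSectorialSolution (u p) (F.vMatrix w u s p) (fun k => Φ k p)
        (sector (φ - ε) (φ + Real.pi + ε)) Yleft ∧
      ∀ z ∈ sector (φ - ε) (φ + ε), Yleft z = Yright z * S

/-- `C` is the central connection matrix, at the point `p`, subjected to the oriented line of angle
`φ`, for the calibration `θ` associated to `(μ, R)`: `Y_right = Y_0 C` in the sector around the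
positive half-line. -/
def IsCentralConnectionMatrix (F : FrobeniusData n M) (B : Set M) (w u s : M → Fin n → ℂ)
    (θ : Fin n → ℕ → M → ℂ) (μ : Fin n → ℂ) (R : Matrix (Fin n) (Fin n) ℂ) (φ : ℝ) (p : M)
    (C : Matrix (Fin n) (Fin n) ℂ) : Prop :=
  ∃ Φ : ℕ → M → Matrix (Fin n) (Fin n) ℂ, IsFormalSolution B u (F.vMatrix w u s) Φ ∧
    ∃ ε : ℝ, 0 < ε ∧ ε < Real.pi / 2 ∧ ∃ Yright : ℂ → Matrix (Fin n) (Fin n) ℂ,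
      IsSectorialSolution (u p) (F.vMatrix w u s p) (fun k => Φ k p)
        (sector (φ - Real.pi - ε) (φ + ε)) Yright ∧
      ∀ r t : ℝ, 0 < r → φ - ε < t → t < φ + ε →
        Yright (r * Complex.exp (t * Complex.I)) =
          F.solutionAtZero w u s θ μ R p (Real.log r + t * Complex.I) * C

end FrobeniusData

end

/-! Multiplication by `∂_κ` is an isometry from the new metric to the old one, and everything
follows from the fact that it also carries the new flat frame to the old one. Since `∇θ_{κ,0} =
∂_κ`, the function `Ω_{α,m;κ,0}` is `∂_κ θ_{α,m+1}`, and the recursion of the calibration gives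
`X(θ̂_{α,m}) = (∂_κ · X)(θ_{α,m})` (`IsCalibration.dirDeriv_legendreCalibration`). For `m = 0` this
reads `dv̂ = dv ∘ (∂_κ ·)`, that is, `∂_κ · ∂/∂v̂^α = ∂/∂v^α`. Hence the Gram matrices, the series
`Θ` and the matrices of `E ·` coincide.

For `Ψ`, the differentials of the canonical coordinates must be multiplicative: `du_i(X · Y) =
du_i(X) du_i(Y)`. Then `ψ̂_{iα} = s_i du_i(∂_κ) du_i(∂/∂v̂^α) = s_i du_i(∂/∂v^α) = ψ_{iα}`. As the
`u_i` are given only as the eigenvalues of `E ·`, multiplicativity has to be proved. Homogeneity and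
the symmetry of `∇c` give `∂_β 𝓤 = C_β + [C_β, μ]`, where `C_β` is multiplication by `∂_β`. It
commutes with `𝓤`, so the commutator has no diagonal part in an eigenbasis of `𝓤`, and first order
perturbation theory (`mulVec_eigenvector_of_deriv`) makes `∂_β u_i` the eigenvalues of `C_β`.

The new components of `E` are the entries `𝓤^α_κ`, so the same derivative formula, together with the
charge `-2 μ_κ`, shows that the grading matrix is again `diag(μ)`. Thus `V` and `Y_0` are the same
for both structures, and so are the defining properties of `Φ`, `S` and `C`. Equality of any two
such objects is uniqueness: distinct `u_i` determine the formal series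
(`formal_coefficients_unique`), and its asymptotics in a sector wider than `π` determine the
solution (`IsSectorialSolution.unique`). -/

noncomputable section

/-! ### Differential calculus in holomorphic coordinates. -/

section Calculus

variable {n : ℕ} {M : Type*} [TopologicalSpace M] [ChartedSpace (Fin n → ℂ) M]

theorem dCoord_coordVec {w : M → Fin n → ℂ} {p : M} (hw : (dCoord w p).IsInvertible) (α : Fin n) :
    dCoord w p (coordVec w p α) = Pi.single α 1 := by
  obtain ⟨T, hT⟩ := hw
  simp [coordVec, ← hT]

theorem dCoord_injective {w : M → Fin n → ℂ} {p : M} (hw : (dCoord w p).IsInvertible) :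
    Function.Injective (dCoord w p) := by
  obtain ⟨T, hT⟩ := hw
  rw [← hT]; exact T.injective

theorem dCoord_isInvertible_of_injective {w : M → Fin n → ℂ} {p : M}
    (hw : Function.Injective (dCoord w p)) : (dCoord w p).IsInvertible := by
  let A : (Fin n → ℂ) →L[ℂ] (Fin n → ℂ) := dCoord w p
  let e : (Fin n → ℂ) ≃L[ℂ] (Fin n → ℂ) :=
    (LinearEquiv.ofInjectiveEndo A.toLinearMap hw).toContinuousLinearEquiv
  have he : (e : (Fin n → ℂ) →L[ℂ] (Fin n → ℂ)) = A := ContinuousLinearMap.ext fun X => rfl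
  exact ⟨e, he⟩

theorem eq_sum_coordVec {w : M → Fin n → ℂ} {p : M} (hw : (dCoord w p).IsInvertible)
    (X : TangentSpace 𝓘(ℂ, Fin n → ℂ) p) :
    X = ∑ α, dCoord w p X α • coordVec w p α := by
  apply dCoord_injective hw
  ext j
  simp [map_sum, dCoord_coordVec hw, Finset.sum_apply, Pi.single_apply]

theorem dirDeriv_eq_sum {w : M → Fin n → ℂ} {p : M} (hw : (dCoord w p).IsInvertible) (f : M → ℂ)
    (X : TangentSpace 𝓘(ℂ, Fin n → ℂ) p) :
    dirDeriv f p X = ∑ α, dCoord w p X α * coordDeriv w α f p := by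
  conv_lhs => rw [eq_sum_coordVec hw X]
  simp only [dirDeriv, coordDeriv]
  rw [map_sum]
  refine Finset.sum_congr rfl fun α _ => ?_
  rw [map_smul]
  rfl

theorem dirDeriv_congr {f g : M → ℂ} {p : M} (h : f =ᶠ[𝓝 p] g)
    (X : TangentSpace 𝓘(ℂ, Fin n → ℂ) p) : dirDeriv f p X = dirDeriv g p X := by
  simp only [dirDeriv]
  rw [h.mfderiv_eq]
  rfl

theorem dirDeriv_const (c : ℂ) (p : M) (X : TangentSpace 𝓘(ℂ, Fin n → ℂ) p) :
    dirDeriv (fun _ => c) p X = 0 := by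
  simp only [dirDeriv]
  rw [mfderiv_const]
  rfl

theorem dirDeriv_mul {f g : M → ℂ} {p : M}
    (hf : MDifferentiableAt 𝓘(ℂ, Fin n → ℂ) 𝓘(ℂ, ℂ) f p)
    (hg : MDifferentiableAt 𝓘(ℂ, Fin n → ℂ) 𝓘(ℂ, ℂ) g p)
    (X : TangentSpace 𝓘(ℂ, Fin n → ℂ) p) :
    dirDeriv (fun q => f q * g q) p X = f p * dirDeriv g p X + g p * dirDeriv f p X := by
  have h := (hf.hasMFDerivAt.mul hg.hasMFDerivAt).mfderiv
  simp only [dirDeriv]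
  have h2 : (fun q => f q * g q) = f * g := rfl
  rw [h2, h]
  rfl

theorem dirDeriv_add {f g : M → ℂ} {p : M}
    (hf : MDifferentiableAt 𝓘(ℂ, Fin n → ℂ) 𝓘(ℂ, ℂ) f p)
    (hg : MDifferentiableAt 𝓘(ℂ, Fin n → ℂ) 𝓘(ℂ, ℂ) g p)
    (X : TangentSpace 𝓘(ℂ, Fin n → ℂ) p) :
    dirDeriv (fun q => f q + g q) p X = dirDeriv f p X + dirDeriv g p X := by
  have h := (hf.hasMFDerivAt.add hg.hasMFDerivAt).mfderiv
  simp only [dirDeriv]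
  have h2 : (fun q => f q + g q) = f + g := rfl
  rw [h2, h]
  rfl

theorem dirDeriv_const_mul (c : ℂ) {f : M → ℂ} {p : M}
    (hf : MDifferentiableAt 𝓘(ℂ, Fin n → ℂ) 𝓘(ℂ, ℂ) f p)
    (X : TangentSpace 𝓘(ℂ, Fin n → ℂ) p) :
    dirDeriv (fun q => c * f q) p X = c * dirDeriv f p X := by
  rw [dirDeriv_mul mdifferentiableAt_const hf, dirDeriv_const, mul_zero, add_zero]

/-- Differentiability and the value are proved together because the induction step for the value
needs the differentiability of the partial sum. -/
theorem dirDeriv_sum {ι : Type*} (t : Finset ι) {f : ι → M → ℂ} {p : M}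
    (hf : ∀ i ∈ t, MDifferentiableAt 𝓘(ℂ, Fin n → ℂ) 𝓘(ℂ, ℂ) (f i) p)
    (X : TangentSpace 𝓘(ℂ, Fin n → ℂ) p) :
    MDifferentiableAt 𝓘(ℂ, Fin n → ℂ) 𝓘(ℂ, ℂ) (fun q => ∑ i ∈ t, f i q) p ∧
    dirDeriv (fun q => ∑ i ∈ t, f i q) p X = ∑ i ∈ t, dirDeriv (f i) p X := by
  classical
  induction t using Finset.induction_on with
  | empty => simp [mdifferentiableAt_const, dirDeriv_const]
  | insert a t ha ih =>
    obtain ⟨h1, h2⟩ := ih fun i hi => hf i (Finset.mem_insert_of_mem hi)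
    have h3 := hf a (Finset.mem_insert_self a t)
    simp only [Finset.sum_insert ha]
    exact ⟨h3.add h1, by rw [dirDeriv_add h3 h1, h2]⟩

theorem dirDeriv_sum_const_mul {ι : Type*} (t : Finset ι) (c : ι → ℂ) {f : ι → M → ℂ} {p : M}
    (hf : ∀ i ∈ t, MDifferentiableAt 𝓘(ℂ, Fin n → ℂ) 𝓘(ℂ, ℂ) (f i) p)
    (X : TangentSpace 𝓘(ℂ, Fin n → ℂ) p) :
    dirDeriv (fun q => ∑ i ∈ t, c i * f i q) p X = ∑ i ∈ t, c i * dirDeriv (f i) p X := by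
  rw [(dirDeriv_sum t (f := fun i q => c i * f i q)
    (fun i hi => mdifferentiableAt_const.mul (hf i hi)) X).2]
  exact Finset.sum_congr rfl fun i hi => dirDeriv_const_mul _ (hf i hi) X

theorem dCoord_apply {w : M → Fin n → ℂ} {p : M}
    (hw : ∀ i, MDifferentiableAt 𝓘(ℂ, Fin n → ℂ) 𝓘(ℂ, ℂ) (fun q => w q i) p)
    (X : TangentSpace 𝓘(ℂ, Fin n → ℂ) p) (i : Fin n) :
    dCoord w p X i = dirDeriv (fun q => w q i) p X := by
  have h : HasMFDerivAt 𝓘(ℂ, Fin n → ℂ) 𝓘(ℂ, Fin n → ℂ) w p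
      (ContinuousLinearMap.pi fun i => (mfderiv 𝓘(ℂ, Fin n → ℂ) 𝓘(ℂ, ℂ) (fun q => w q i) p :
        (Fin n → ℂ) →L[ℂ] ℂ)) := by
    constructor
    · exact continuousAt_pi.2 fun i => (hw i).continuousAt
    · refine hasFDerivWithinAt_pi.2 fun i => ?_
      exact (hw i).hasMFDerivAt.2
  simp only [dCoord]
  rw [h.mfderiv]
  rfl

theorem IsHolomorphicOn.mdifferentiableAt {B : Set M} {f : M → ℂ} (hf : IsHolomorphicOn n B f)
    (hB : IsOpen B) {p : M} (hp : p ∈ B) :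
    MDifferentiableAt 𝓘(ℂ, Fin n → ℂ) 𝓘(ℂ, ℂ) f p :=
  ((hf p hp).contMDiffAt (hB.mem_nhds hp)).mdifferentiableAt (by simp)

theorem IsHolomorphicOn.sum_const_mul {ι : Type*} {B : Set M} (t : Finset ι) (c : ι → ℂ)
    {f : ι → M → ℂ} (hf : ∀ i ∈ t, IsHolomorphicOn n B (f i)) :
    IsHolomorphicOn n B (fun q => ∑ i ∈ t, c i * f i q) :=
  contMDiffOn_finsetSum fun i hi => contMDiffOn_const.mul (hf i hi)

theorem IsHolomorphicOn.mul {B : Set M} {f g : M → ℂ} (hf : IsHolomorphicOn n B f)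
    (hg : IsHolomorphicOn n B g) : IsHolomorphicOn n B (fun q => f q * g q) :=
  ContMDiffOn.mul hf hg

variable {v : OpenPartialHomeomorph M (Fin n → ℂ)}

/-- Differentiating both compositions of the chart with its inverse gives a two-sided inverse of the
differential. -/
theorem dCoord_chart_isInvertible
    (hv : v ∈ IsManifold.maximalAtlas 𝓘(ℂ, Fin n → ℂ) ω M)
    {p : M} (hp : p ∈ v.source) : (dCoord v p).IsInvertible := by
  have h1 : MDifferentiableAt 𝓘(ℂ, Fin n → ℂ) 𝓘(ℂ, Fin n → ℂ) v p :=
    (contMDiffAt_of_mem_maximalAtlas hv hp).mdifferentiableAt (by simp)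
  have h2 : MDifferentiableAt 𝓘(ℂ, Fin n → ℂ) 𝓘(ℂ, Fin n → ℂ) v.symm (v p) :=
    (contMDiffAt_symm_of_mem_maximalAtlas hv (v.map_source hp)).mdifferentiableAt (by simp)
  have h3 : (mfderiv 𝓘(ℂ, Fin n → ℂ) 𝓘(ℂ, Fin n → ℂ) v.symm (v p)).comp
      (mfderiv 𝓘(ℂ, Fin n → ℂ) 𝓘(ℂ, Fin n → ℂ) v p) = ContinuousLinearMap.id ℂ _ := by
    rw [← mfderiv_comp p h2 h1, ← mfderiv_id]
    exact Filter.EventuallyEq.mfderiv_eq (v.eventually_left_inverse hp)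
  have h1' : MDifferentiableAt 𝓘(ℂ, Fin n → ℂ) 𝓘(ℂ, Fin n → ℂ) v (v.symm (v p)) := by
    rwa [v.left_inv hp]
  have h4 : (mfderiv 𝓘(ℂ, Fin n → ℂ) 𝓘(ℂ, Fin n → ℂ) v (v.symm (v p))).comp
      (mfderiv 𝓘(ℂ, Fin n → ℂ) 𝓘(ℂ, Fin n → ℂ) v.symm (v p)) = ContinuousLinearMap.id ℂ _ := by
    rw [← mfderiv_comp (v p) h1' h2, ← mfderiv_id]
    exact Filter.EventuallyEq.mfderiv_eq (v.eventually_right_inverse (v.map_source hp))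
  rw [v.left_inv hp] at h4
  exact ContinuousLinearMap.IsInvertible.of_inverse (g := mfderiv 𝓘(ℂ, Fin n → ℂ) 𝓘(ℂ, Fin n → ℂ) v.symm (v p)) h4 h3

theorem isHolomorphicOn_chart_apply
    (hv : v ∈ IsManifold.maximalAtlas 𝓘(ℂ, Fin n → ℂ) ω M)
    (i : Fin n) : IsHolomorphicOn n v.source (fun q => v q i) := by
  have := contMDiffOn_of_mem_maximalAtlas hv
  exact (contMDiffOn_pi_space.1 this) i

theorem dirDeriv_eq_fderiv
    (hv : v ∈ IsManifold.maximalAtlas 𝓘(ℂ, Fin n → ℂ) ω M)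
    {f : M → ℂ} {p : M} (hp : p ∈ v.source)
    (hf : MDifferentiableAt 𝓘(ℂ, Fin n → ℂ) 𝓘(ℂ, ℂ) f p) (X : TangentSpace 𝓘(ℂ, Fin n → ℂ) p) :
    DifferentiableAt ℂ (f ∘ v.symm) (v p) ∧
    dirDeriv f p X = fderiv ℂ (f ∘ v.symm) (v p) (dCoord v p X) := by
  have h1 : MDifferentiableAt 𝓘(ℂ, Fin n → ℂ) 𝓘(ℂ, Fin n → ℂ) v p :=
    (contMDiffAt_of_mem_maximalAtlas hv hp).mdifferentiableAt (by simp)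
  have h2 : MDifferentiableAt 𝓘(ℂ, Fin n → ℂ) 𝓘(ℂ, Fin n → ℂ) v.symm (v p) :=
    (contMDiffAt_symm_of_mem_maximalAtlas hv (v.map_source hp)).mdifferentiableAt (by simp)
  have h3 : MDifferentiableAt 𝓘(ℂ, Fin n → ℂ) 𝓘(ℂ, ℂ) (f ∘ v.symm) (v p) := by
    refine MDifferentiableAt.comp (v p) ?_ h2
    rwa [v.left_inv hp]
  refine ⟨mdifferentiableAt_iff_differentiableAt.1 h3, ?_⟩
  have h4 : f =ᶠ[𝓝 p] (f ∘ v.symm) ∘ v := by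
    filter_upwards [v.eventually_left_inverse hp] with q hq
    simp [hq]
  rw [dirDeriv_congr h4, ← mfderiv_eq_fderiv]
  simp only [dirDeriv]
  rw [mfderiv_comp p h3 h1]
  rfl

/-- Read in the chart, this is the Fréchet derivative applied to a constant vector; in the class `ω`
differentiation loses no regularity. -/
theorem IsHolomorphicOn.coordDeriv
    (hv : v ∈ IsManifold.maximalAtlas 𝓘(ℂ, Fin n → ℂ) ω M)
    {f : M → ℂ} (hf : IsHolomorphicOn n v.source f) (α : Fin n) :
    IsHolomorphicOn n v.source (coordDeriv v α f) := by
  have h1 : ContDiffOn ℂ ω (f ∘ v.symm) v.target := by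
    rw [← contMDiffOn_iff_contDiffOn]
    exact ContMDiffOn.comp hf (contMDiffOn_symm_of_mem_maximalAtlas hv)
      fun x hx => v.map_target hx
  have h2 : ContDiffOn ℂ ω (fun x => fderiv ℂ (f ∘ v.symm) x (Pi.single α 1)) v.target :=
    (h1.fderiv_of_isOpen (m := ω) v.open_target (by simp)).clm_apply contDiffOn_const
  have h3 := ContMDiffOn.comp (contMDiffOn_iff_contDiffOn.2 h2)
    (contMDiffOn_of_mem_maximalAtlas hv) fun x hx => v.map_source hx
  refine ContMDiffOn.congr h3 fun p hp => ?_
  have := (dirDeriv_eq_fderiv hv hp (hf.mdifferentiableAt v.open_source hp) (coordVec v p α)).2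
  rw [dCoord_coordVec (dCoord_chart_isInvertible hv hp)] at this
  exact this

/-- The representation of a vector field in a chart. -/
def chartField (v : OpenPartialHomeomorph M (Fin n → ℂ))
    (X : ∀ p : M, TangentSpace 𝓘(ℂ, Fin n → ℂ) p) (x : Fin n → ℂ) :
    TangentSpace 𝓘(ℂ, Fin n → ℂ) x :=
  dCoord v (v.symm x) (X (v.symm x))

theorem mpullback_chartField
    (hv : v ∈ IsManifold.maximalAtlas 𝓘(ℂ, Fin n → ℂ) ω M)
    (X : ∀ p : M, TangentSpace 𝓘(ℂ, Fin n → ℂ) p) {p : M} (hp : p ∈ v.source) :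
    VectorField.mpullback 𝓘(ℂ, Fin n → ℂ) 𝓘(ℂ, Fin n → ℂ) v (chartField v X) p = X p := by
  obtain ⟨T, hT⟩ := dCoord_chart_isInvertible hv hp
  have h : chartField v X (v p) = dCoord v p (X p) := by
    simp only [chartField]
    rw [v.left_inv hp]
  rw [VectorField.mpullback_apply, h]
  change (dCoord v p).inverse _ = _
  rw [← hT]
  simp

theorem contDiffOn_chartField
    (hv : v ∈ IsManifold.maximalAtlas 𝓘(ℂ, Fin n → ℂ) ω M)
    {X : ∀ p : M, TangentSpace 𝓘(ℂ, Fin n → ℂ) p}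
    (hX : ∀ i, IsHolomorphicOn n v.source (fun q => dCoord v q (X q) i)) :
    ContDiffOn ℂ ω (E := Fin n → ℂ) (F := Fin n → ℂ) (chartField v X) v.target := by
  refine contMDiffOn_iff_contDiffOn.1 ?_
  have : ContMDiffOn 𝓘(ℂ, Fin n → ℂ) 𝓘(ℂ, Fin n → ℂ) ω
      (fun q => (dCoord v q (X q) : Fin n → ℂ)) v.source := contMDiffOn_pi_space.2 hX
  exact this.comp (contMDiffOn_symm_of_mem_maximalAtlas hv) fun x hx => v.map_target hx

/-- Such a field is the pullback of its chart representation. This makes the coordinate fields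
admissible in the axioms, which quantify over holomorphic fields. -/
theorem isHolomorphicField_of_components [IsManifold 𝓘(ℂ, Fin n → ℂ) ω M]
    (hv : v ∈ IsManifold.maximalAtlas 𝓘(ℂ, Fin n → ℂ) ω M)
    {X : ∀ p : M, TangentSpace 𝓘(ℂ, Fin n → ℂ) p}
    (hX : ∀ i, IsHolomorphicOn n v.source (fun q => dCoord v q (X q) i)) :
    IsHolomorphicField v.source X := by
  intro p hp
  have h2 := contMDiffAt_vectorSpace_iff_contDiffAt.2
    ((contDiffOn_chartField hv hX).contDiffAt (v.open_target.mem_nhds (v.map_source hp)))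
  have h3 := ContMDiffAt.mpullback_vectorField_preimage h2
    (contMDiffAt_of_mem_maximalAtlas hv hp) (dCoord_chart_isInvertible hv hp) (by simp)
  refine (h3.congr_of_eventuallyEq ?_).contMDiffWithinAt
  filter_upwards [v.open_source.mem_nhds hp] with q hq
  rw [mpullback_chartField hv X hq]

theorem dirDeriv_dCoord_field
    (hv : v ∈ IsManifold.maximalAtlas 𝓘(ℂ, Fin n → ℂ) ω M)
    {X : ∀ p : M, TangentSpace 𝓘(ℂ, Fin n → ℂ) p} {p : M} (hp : p ∈ v.source)
    (hX : ∀ i, IsHolomorphicOn n v.source (fun q => dCoord v q (X q) i))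
    (Z : TangentSpace 𝓘(ℂ, Fin n → ℂ) p) (i : Fin n) :
    dirDeriv (fun q => dCoord v q (X q) i) p Z =
      fderiv ℂ (E := Fin n → ℂ) (F := Fin n → ℂ) (chartField v X) (v p) (dCoord v p Z) i := by
  have h1 : DifferentiableAt ℂ (E := Fin n → ℂ) (F := Fin n → ℂ) (chartField v X) (v p) :=
    ((contDiffOn_chartField hv hX).contDiffAt
      (v.open_target.mem_nhds (v.map_source hp))).differentiableAt (by simp)
  rw [(dirDeriv_eq_fderiv hv hp ((hX i).mdifferentiableAt v.open_source hp) Z).2]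
  have h2 := (hasFDerivAt_pi'.1 h1.hasFDerivAt i).fderiv
  exact congrArg (fun T : (Fin n → ℂ) →L[ℂ] ℂ => T (dCoord v p Z)) h2

/-- The components of a Lie bracket in a chart. -/
theorem dCoord_mlieBracket [IsManifold 𝓘(ℂ, Fin n → ℂ) ω M]
    (hv : v ∈ IsManifold.maximalAtlas 𝓘(ℂ, Fin n → ℂ) ω M)
    {X Y : ∀ p : M, TangentSpace 𝓘(ℂ, Fin n → ℂ) p} {p : M} (hp : p ∈ v.source)
    (hX : ∀ i, IsHolomorphicOn n v.source (fun q => dCoord v q (X q) i))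
    (hY : ∀ i, IsHolomorphicOn n v.source (fun q => dCoord v q (Y q) i)) (i : Fin n) :
    dCoord v p (VectorField.mlieBracket 𝓘(ℂ, Fin n → ℂ) X Y p) i =
      dirDeriv (fun q => dCoord v q (Y q) i) p (X p) -
      dirDeriv (fun q => dCoord v q (X q) i) p (Y p) := by
  -- The bracket commutes with pullback along the chart, so it can be computed for the
  -- representations in `ℂⁿ`, where it is a difference of Fréchet derivatives.
  have hc : ∀ X : ∀ p : M, TangentSpace 𝓘(ℂ, Fin n → ℂ) p,
      X =ᶠ[𝓝 p] VectorField.mpullback 𝓘(ℂ, Fin n → ℂ) 𝓘(ℂ, Fin n → ℂ) v (chartField v X) := by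
    intro X
    filter_upwards [v.open_source.mem_nhds hp] with q hq
    rw [mpullback_chartField hv X hq]
  have hm : ∀ {X : ∀ p : M, TangentSpace 𝓘(ℂ, Fin n → ℂ) p},
      (∀ i, IsHolomorphicOn n v.source (fun q => dCoord v q (X q) i)) →
      MDifferentiableAt 𝓘(ℂ, Fin n → ℂ) 𝓘(ℂ, Fin n → ℂ).tangent
        (fun x => (⟨x, chartField v X x⟩ : TangentBundle 𝓘(ℂ, Fin n → ℂ) (Fin n → ℂ))) (v p) :=
    fun hX => (contMDiffAt_vectorSpace_iff_contDiffAt.2 ((contDiffOn_chartField hv hX).contDiffAt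
      (v.open_target.mem_nhds (v.map_source hp)))).mdifferentiableAt (by simp)
  have hb : ∀ X : ∀ p : M, TangentSpace 𝓘(ℂ, Fin n → ℂ) p,
      chartField v X (v p) = dCoord v p (X p) := by
    intro X
    simp only [chartField]
    rw [v.left_inv hp]
  rw [(hc X).mlieBracket_vectorField_eq (hc Y), ← VectorField.mpullback_mlieBracket (hm hX) (hm hY)
    (contMDiffAt_of_mem_maximalAtlas hv hp) (by simp), dirDeriv_dCoord_field hv hp hX,
    dirDeriv_dCoord_field hv hp hY, ← hb X, ← hb Y]
  obtain ⟨T, hT⟩ := dCoord_chart_isInvertible hv hp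
  have hl : VectorField.mlieBracket 𝓘(ℂ, Fin n → ℂ) (chartField v X) (chartField v Y) (v p) =
      VectorField.lieBracket ℂ (E := Fin n → ℂ) (chartField v X) (chartField v Y) (v p) :=
    (congrFun (VectorField.mlieBracketWithin_eq_lieBracketWithin (s := Set.univ)) _).trans
      (congrFun (VectorField.lieBracketWithin_univ (E := Fin n → ℂ)) _)
  rw [VectorField.mpullback_apply, hl]
  change dCoord v p ((dCoord v p).inverse _) i = _
  rw [← hT, ContinuousLinearMap.inverse_equiv]
  exact congrFun (T.apply_symm_apply _) i

end Calculus

/-! ### First order perturbation of simple eigenvalues. -/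

section EigenvalueDerivative

open Matrix

variable {n : ℕ}

theorem charpoly_eq_prod_of_det {U : Matrix (Fin n) (Fin n) ℂ} {u : Fin n → ℂ}
    (h : ∀ z : ℂ, (z • (1 : Matrix (Fin n) (Fin n) ℂ) - U).det = ∏ i, (z - u i)) :
    U.charpoly = ∏ i, (Polynomial.X - Polynomial.C (u i)) := by
  refine Polynomial.funext fun z => ?_
  rw [Matrix.eval_charpoly, Polynomial.eval_prod]
  simpa [Matrix.scalar_apply, Matrix.smul_one_eq_diagonal] using h z

/-- The product of the matrices `U - u_l`, `l` in a list, applied to a vector. -/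
def shiftFold (U : Matrix (Fin n) (Fin n) ℂ) (u : Fin n → ℂ) (L : List (Fin n)) (x : Fin n → ℂ) :
    Fin n → ℂ :=
  L.foldr (fun l y => U *ᵥ y - u l • y) x

/-- The polynomial form brings in Cayley–Hamilton: over all indices, the product is the
characteristic polynomial evaluated at `U`. -/
theorem shiftFold_eq_aeval (U : Matrix (Fin n) (Fin n) ℂ) (u : Fin n → ℂ) (L : List (Fin n))
    (x : Fin n → ℂ) :
    shiftFold U u L x = (Polynomial.aeval U
      (L.map fun l => (Polynomial.X - Polynomial.C (u l))).prod) *ᵥ x := by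
  induction L with
  | nil => simp [shiftFold]
  | cons l L ih =>
    have : shiftFold U u (l :: L) x = U *ᵥ shiftFold U u L x - u l • shiftFold U u L x := rfl
    rw [this, ih, List.map_cons, List.prod_cons, map_mul, ← Matrix.mulVec_mulVec]
    simp [sub_mul, Matrix.sub_mulVec, Algebra.algebraMap_eq_smul_one, Matrix.smul_mulVec]

theorem shiftFold_of_eigenvector {U : Matrix (Fin n) (Fin n) ℂ} {u : Fin n → ℂ} {c : ℂ}
    {x : Fin n → ℂ} (hx : U *ᵥ x = c • x) (L : List (Fin n)) :
    shiftFold U u L x = (L.map fun l => c - u l).prod • x := by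
  induction L with
  | nil => simp [shiftFold]
  | cons l L ih =>
    have : shiftFold U u (l :: L) x = U *ᵥ shiftFold U u L x - u l • shiftFold U u L x := rfl
    rw [this, ih, List.map_cons, List.prod_cons, Matrix.mulVec_smul, hx, smul_smul, smul_smul,
      ← sub_smul]
    congr 1
    ring

theorem differentiableAt_shiftFold {U : ℂ → Matrix (Fin n) (Fin n) ℂ} {u : ℂ → Fin n → ℂ} {t : ℂ}
    (hU : ∀ a b, DifferentiableAt ℂ (fun s => U s a b) t)
    (hu : ∀ i, DifferentiableAt ℂ (fun s => u s i) t) (L : List (Fin n)) (x : Fin n → ℂ)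
    (a : Fin n) : DifferentiableAt ℂ (fun s => shiftFold (U s) (u s) L x a) t := by
  induction L generalizing a with
  | nil => exact differentiableAt_const _
  | cons l L ih =>
    have : (fun s => shiftFold (U s) (u s) (l :: L) x a) = fun s =>
        (∑ b, U s a b * shiftFold (U s) (u s) L x b) - u s l * shiftFold (U s) (u s) L x a := rfl
    rw [this]
    exact (DifferentiableAt.fun_sum fun b _ => (hU a b).mul (ih b)).sub ((hu l).mul (ih a))

theorem exists_eigenbasis {U : Matrix (Fin n) (Fin n) ℂ} {u : Fin n → ℂ}
    (h : ∀ z : ℂ, (z • (1 : Matrix (Fin n) (Fin n) ℂ) - U).det = ∏ i, (z - u i))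
    (hu : Function.Injective u) :
    ∃ b : Module.Basis (Fin n) ℂ (Fin n → ℂ), ∀ i, U *ᵥ b i = u i • b i := by
  have h1 : ∀ i, ∃ x : Fin n → ℂ, x ≠ 0 ∧ U *ᵥ x = u i • x := by
    intro i
    have h2 : (u i • (1 : Matrix (Fin n) (Fin n) ℂ) - U).det = 0 := by
      rw [h]; exact Finset.prod_eq_zero (Finset.mem_univ i) (sub_self _)
    obtain ⟨x, hx, hx2⟩ := Matrix.exists_mulVec_eq_zero_iff.2 h2
    refine ⟨x, hx, ?_⟩
    rw [Matrix.sub_mulVec, Matrix.smul_mulVec, Matrix.one_mulVec, sub_eq_zero] at hx2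
    exact hx2.symm
  choose x hx hx2 using h1
  have hli : LinearIndependent ℂ x :=
    Module.End.eigenvectors_linearIndependent' (Matrix.mulVecLin U) u hu x fun i =>
      ⟨Module.End.mem_eigenspace_iff.2 (hx2 i), hx i⟩
  refine ⟨Module.Basis.mk hli (hli.span_eq_top_of_card_eq_finrank' (by simp)).ge, fun i => ?_⟩
  simpa using hx2 i

/-- The coordinate functionals of an eigenbasis are left eigenvectors. -/
theorem coord_mulVec_of_eigenbasis {W : Matrix (Fin n) (Fin n) ℂ} {w : Fin n → ℂ}
    {b : Module.Basis (Fin n) ℂ (Fin n → ℂ)} (hb : ∀ i, W *ᵥ b i = w i • b i) (i : Fin n)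
    (x : Fin n → ℂ) : b.coord i (W *ᵥ x) = w i * b.coord i x := by
  have : (b.coord i).comp (Matrix.mulVecLin W) = w i • b.coord i := by
    refine b.ext fun j => ?_
    simp only [LinearMap.comp_apply, Matrix.mulVecLin_apply, hb, map_smul, LinearMap.smul_apply,
      Module.Basis.coord_apply, Module.Basis.repr_self, smul_eq_mul, Finsupp.single_apply]
    split_ifs with h
    · rw [h]
    · simp
  exact congrArg (fun f : (Fin n → ℂ) →ₗ[ℂ] ℂ => f x) this

theorem eq_smul_of_eigenbasis {U : Matrix (Fin n) (Fin n) ℂ} {u : Fin n → ℂ}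
    {b : Module.Basis (Fin n) ℂ (Fin n → ℂ)} (hb : ∀ i, U *ᵥ b i = u i • b i)
    (hu : Function.Injective u) {i : Fin n} {x : Fin n → ℂ} (hx : U *ᵥ x = u i • x) :
    x = b.coord i x • b i := by
  refine b.ext_elem fun j => ?_
  have h := coord_mulVec_of_eigenbasis hb j x
  rw [hx, map_smul, smul_eq_mul] at h
  simp only [Module.Basis.coord_apply] at h
  simp only [map_smul, Module.Basis.repr_self, Finsupp.smul_apply, Finsupp.single_apply,
    Module.Basis.coord_apply, smul_eq_mul]
  split_ifs with hij
  · simp [hij]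
  · have : u i ≠ u j := fun e => hij (hu e)
    rw [mul_zero]
    by_contra hne
    exact this (mul_right_cancel₀ hne h)

/-- First order perturbation theory: if the derivative of a matrix `U(t)` with distinct eigenvalues
`u_i(t)` is `C + [A, C]`, where `C` commutes with `U`, then `C` has the eigenvalues `u_i'`. -/
theorem mulVec_eigenvector_of_deriv {U : ℂ → Matrix (Fin n) (Fin n) ℂ} {u : ℂ → Fin n → ℂ}
    {C A : Matrix (Fin n) (Fin n) ℂ} {u' : Fin n → ℂ}
    (hU : ∀ a b, HasDerivAt (fun t => U t a b) ((C + A * C - C * A) a b) 0)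
    (hu : ∀ i, HasDerivAt (fun t => u t i) (u' i) 0)
    (hdet : ∀ᶠ t in 𝓝 (0 : ℂ), ∀ z : ℂ,
      (z • (1 : Matrix (Fin n) (Fin n) ℂ) - U t).det = ∏ i, (z - u t i))
    (hinj : Function.Injective (u 0)) (hC : C * U 0 = U 0 * C)
    {b : Module.Basis (Fin n) ℂ (Fin n → ℂ)} (hb : ∀ i, U 0 *ᵥ b i = u 0 i • b i) (i : Fin n) :
    C *ᵥ b i = u' i • b i := by
  -- A matrix commuting with `U 0` preserves its eigenspaces, which are lines.
  have hCb : ∀ j, C *ᵥ b j = b.coord j (C *ᵥ b j) • b j := fun j => by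
    refine eq_smul_of_eigenbasis hb hinj ?_
    rw [Matrix.mulVec_mulVec, ← hC, ← Matrix.mulVec_mulVec, hb, Matrix.mulVec_smul]
  set w : Fin n → ℂ := fun j => b.coord j (C *ᵥ b j) with hw
  have hCb' : ∀ j, C *ᵥ b j = w j • b j := hCb
  set L := (Finset.univ.erase i).toList with hL
  -- Applying `∏_{l ≠ i} (U t - u_l)` to the fixed vector `b i` yields a differentiable family
  -- annihilated by `U t - u_i` (Cayley–Hamilton). At `t = 0` it is a nonzero multiple of `b i`, so
  -- no differentiable choice of eigenvectors is required.
  set x : ℂ → Fin n → ℂ := fun t => shiftFold (U t) (u t) L (b i) with hx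
  set c : ℂ := (L.map fun l => u 0 i - u 0 l).prod with hc
  have hc0 : c ≠ 0 := by
    rw [hc, Ne, List.prod_eq_zero_iff]
    simp only [List.mem_map, not_exists, not_and]
    intro l hl h0
    rw [hL, Finset.mem_toList, Finset.mem_erase] at hl
    exact hl.1 (hinj (sub_eq_zero.1 h0)).symm
  have hx0 : x 0 = c • b i := shiftFold_of_eigenvector (hb i) L
  have hev : ∀ᶠ t in 𝓝 (0 : ℂ), U t *ᵥ x t - u t i • x t = 0 := by
    filter_upwards [hdet] with t ht
    have h1 : U t *ᵥ x t - u t i • x t = shiftFold (U t) (u t) (i :: L) (b i) := rfl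
    rw [h1, shiftFold_eq_aeval, List.map_cons, List.prod_cons, hL, Finset.prod_map_toList,
      Finset.mul_prod_erase Finset.univ (fun l => Polynomial.X - Polynomial.C (u t l))
        (Finset.mem_univ i), ← charpoly_eq_prod_of_det ht, Matrix.aeval_self_charpoly,
      Matrix.zero_mulVec]
  have hxd : ∀ a, DifferentiableAt ℂ (fun t => x t a) 0 := fun a =>
    differentiableAt_shiftFold (fun a b => (hU a b).differentiableAt)
      (fun j => (hu j).differentiableAt) L (b i) a
  set x' : Fin n → ℂ := fun a => deriv (fun t => x t a) 0 with hx'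
  have hder : (C + A * C - C * A) *ᵥ x 0 + U 0 *ᵥ x' - (u' i • x 0 + u 0 i • x') = 0 := by
    ext a
    have h1 : HasDerivAt (fun t => (∑ k, U t a k * x t k) - u t i * x t a)
        ((∑ k, ((C + A * C - C * A) a k * x 0 k + U 0 a k * x' k)) -
          (u' i * x 0 a + u 0 i * x' a)) 0 :=
      (HasDerivAt.fun_sum fun k _ => (hU a k).mul (hxd k).hasDerivAt).sub
        ((hu i).mul (hxd a).hasDerivAt)
    have h2 : (fun t => (∑ k, U t a k * x t k) - u t i * x t a) =ᶠ[𝓝 0] fun _ => 0 := by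
      filter_upwards [hev] with t ht
      exact congrFun ht a
    have h3 := h1.unique ((hasDerivAt_const (0 : ℂ) (0 : ℂ)).congr_of_eventuallyEq h2)
    rw [Finset.sum_add_distrib] at h3
    exact h3
  -- On the differentiated eigenvalue equation the left eigenvector cancels both the terms in `x'`
  -- and the commutator `[A, C]`; what remains is `c * (w i - u' i) = 0`.
  have hcoord := congrArg (b.coord i) hder
  rw [hx0, map_sub, map_add, map_add, coord_mulVec_of_eigenbasis hb, Matrix.sub_mulVec,
    Matrix.add_mulVec, ← Matrix.mulVec_mulVec, ← Matrix.mulVec_mulVec, map_sub, map_add,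
    coord_mulVec_of_eigenbasis hCb', coord_mulVec_of_eigenbasis hCb', Matrix.mulVec_smul C, hCb',
    Matrix.mulVec_smul A, Matrix.mulVec_smul A, Matrix.mulVec_smul A] at hcoord
  simp only [map_smul, smul_eq_mul, Module.Basis.coord_apply, Module.Basis.repr_self,
    Finsupp.single_eq_same, map_zero] at hcoord
  have h4 : c * (w i - u' i) = 0 := by linear_combination hcoord
  rw [hCb', sub_eq_zero.1 ((mul_eq_zero.1 h4).resolve_left hc0)]

end EigenvalueDerivative

/-! ### Linear systems of differential equations. -/

section MatrixCalculus

variable {n : ℕ} {Y : ℂ → Matrix (Fin n) (Fin n) ℂ} {z : ℂ}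

theorem differentiableAt_matrix_det (hY : ∀ a b, DifferentiableAt ℂ (fun w => Y w a b) z) :
    DifferentiableAt ℂ (fun w => (Y w).det) z := by
  simp only [Matrix.det_apply']
  exact DifferentiableAt.fun_sum fun σ _ => (DifferentiableAt.fun_finsetProd fun i _ => hY _ _).const_mul _

theorem differentiableAt_matrix_inv (hY : ∀ a b, DifferentiableAt ℂ (fun w => Y w a b) z)
    (hdet : (Y z).det ≠ 0) (a b : Fin n) : DifferentiableAt ℂ (fun w => (Y w)⁻¹ a b) z := by
  simp only [Matrix.inv_def, Matrix.smul_apply, Ring.inverse_eq_inv', smul_eq_mul,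
    Matrix.adjugate_apply]
  refine ((differentiableAt_matrix_det hY).inv hdet).mul (differentiableAt_matrix_det fun c d => ?_)
  simp only [Matrix.updateRow_apply]
  split_ifs
  · exact differentiableAt_const _
  · exact hY c d

/-- Two solutions of a linear system on a connected open set differ by a constant factor. -/
theorem exists_eq_mul_of_linear_system {P : Set ℂ} (hP : IsOpen P) (hPc : IsPreconnected P)
    {Y Y' A : ℂ → Matrix (Fin n) (Fin n) ℂ}
    (hY : ∀ z ∈ P, ∀ a b, HasDerivAt (fun z => Y z a b) ((A z * Y z) a b) z)
    (hY' : ∀ z ∈ P, ∀ a b, HasDerivAt (fun z => Y' z a b) ((A z * Y' z) a b) z)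
    (hdet : ∀ z ∈ P, (Y z).det ≠ 0) :
    ∃ T : Matrix (Fin n) (Fin n) ℂ, ∀ z ∈ P, Y' z = Y z * T := by
  have hinv : ∀ z ∈ P, ∀ a b, HasDerivAt (fun z => (Y z)⁻¹ a b) (-((Y z)⁻¹ * A z) a b) z := by
    intro z hz
    have hd := differentiableAt_matrix_inv (fun a b => (hY z hz a b).differentiableAt) (hdet z hz)
    set D : Matrix (Fin n) (Fin n) ℂ := Matrix.of fun a b => deriv (fun z => (Y z)⁻¹ a b) z with hD
    -- Differentiate `Y⁻¹ Y = 1`, which holds near `z`; this gives `(Y⁻¹)' = -Y⁻¹ A`.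
    have h1 : D * Y z + (Y z)⁻¹ * (A z * Y z) = 0 := by
      ext a b
      have h2 : HasDerivAt (fun z => ∑ k, (Y z)⁻¹ a k * Y z k b)
          (∑ k, (D a k * Y z k b + (Y z)⁻¹ a k * (A z * Y z) k b)) z :=
        HasDerivAt.fun_sum fun k _ => (hd a k).hasDerivAt.mul (hY z hz k b)
      have h3 : (fun z => ∑ k, (Y z)⁻¹ a k * Y z k b) =ᶠ[𝓝 z]
          fun _ => (1 : Matrix (Fin n) (Fin n) ℂ) a b := by
        filter_upwards [hP.mem_nhds hz] with w hw
        rw [← Matrix.mul_apply, Matrix.nonsing_inv_mul _ (hdet w hw).isUnit]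
      have h4 := h2.unique ((hasDerivAt_const z _).congr_of_eventuallyEq h3)
      rw [Finset.sum_add_distrib] at h4
      exact h4
    have h5 : D = -((Y z)⁻¹ * A z) := by
      have h6 : (D + (Y z)⁻¹ * A z) * Y z = 0 := by
        rw [add_mul, mul_assoc, h1]
      have h7 := congrArg (· * (Y z)⁻¹) h6
      simp only [zero_mul] at h7
      rw [mul_assoc, Matrix.mul_nonsing_inv _ (hdet z hz).isUnit, mul_one] at h7
      exact eq_neg_of_add_eq_zero_left h7
    intro a b
    have h8 := (hd a b).hasDerivAt
    have h9 : deriv (fun z => (Y z)⁻¹ a b) z = (-((Y z)⁻¹ * A z)) a b := by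
      rw [← h5, hD, Matrix.of_apply]
    rwa [h9] at h8
  -- The two terms `-Y⁻¹ A Y'` and `Y⁻¹ A Y'` cancel, so the quotient is constant on the connected
  -- set `P`.
  have hT : ∀ a b, ∀ z ∈ P, HasDerivAt (fun z => ((Y z)⁻¹ * Y' z) a b) 0 z := by
    intro a b z hz
    have h2 : HasDerivAt (fun z => ∑ k, (Y z)⁻¹ a k * Y' z k b)
        (∑ k, (-((Y z)⁻¹ * A z) a k * Y' z k b + (Y z)⁻¹ a k * (A z * Y' z) k b)) z :=
      HasDerivAt.fun_sum fun k _ => (hinv z hz a k).mul (hY' z hz k b)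
    have h3 : ∑ k, (-((Y z)⁻¹ * A z) a k * Y' z k b + (Y z)⁻¹ a k * (A z * Y' z) k b) =
        (-((Y z)⁻¹ * A z) * Y' z + (Y z)⁻¹ * (A z * Y' z)) a b := by
      rw [Finset.sum_add_distrib]
      rfl
    rw [h3, neg_mul, mul_assoc, neg_add_cancel] at h2
    exact h2
  have hc : ∀ a b, ∃ c, ∀ z ∈ P, ((Y z)⁻¹ * Y' z) a b = c := fun a b =>
    hP.exists_is_const_of_deriv_eq_zero hPc
      (fun z hz => (hT a b z hz).differentiableAt.differentiableWithinAt)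
      (fun z hz => (hT a b z hz).deriv)
  choose T hT using hc
  refine ⟨Matrix.of T, fun z hz => ?_⟩
  have : (Y z)⁻¹ * Y' z = Matrix.of T := by
    ext a b
    exact hT a b z hz
  rw [← this, Matrix.mul_nonsing_inv_cancel_left _ _ (hdet z hz).isUnit]

end MatrixCalculus

/-! ### Geometry of sectors. -/

section Sectors

/-- Openness and connectedness of a sector are inherited from the strip, since `exp` is open and
continuous. -/
theorem sector_eq_image (a b : ℝ) : sector a b = Complex.exp '' {ζ | a < ζ.im ∧ ζ.im < b} := by
  ext z
  constructor
  · rintro ⟨r, t, hr, ha, hb, rfl⟩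
    refine ⟨Real.log r + t * Complex.I, by simpa using ⟨ha, hb⟩, ?_⟩
    rw [Complex.exp_add, ← Complex.ofReal_exp, Real.exp_log hr]
  · rintro ⟨ζ, ⟨ha, hb⟩, rfl⟩
    refine ⟨Real.exp ζ.re, ζ.im, Real.exp_pos _, ha, hb, ?_⟩
    rw [Complex.ofReal_exp, ← Complex.exp_add, Complex.re_add_im]

theorem isOpen_sector (a b : ℝ) : IsOpen (sector a b) := by
  rw [sector_eq_image]
  refine Complex.isOpenMap_exp _ ?_
  exact (isOpen_lt continuous_const Complex.continuous_im).inter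
    (isOpen_lt Complex.continuous_im continuous_const)

theorem isPreconnected_sector (a b : ℝ) : IsPreconnected (sector a b) := by
  rw [sector_eq_image]
  refine IsPreconnected.image (Convex.isPreconnected ?_) _ Complex.continuous_exp.continuousOn
  exact (convex_halfSpace_im_gt a).inter (convex_halfSpace_im_lt b)

theorem sector_mono {a a' b b' : ℝ} (ha : a' ≤ a) (hb : b ≤ b') : sector a b ⊆ sector a' b' := by
  rintro z ⟨r, t, hr, h1, h2, rfl⟩
  exact ⟨r, t, hr, ha.trans_lt h1, h2.trans_le hb, rfl⟩

theorem tendsto_ray {a b t : ℝ} (ha : a < t) (hb : t < b) :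
    Filter.Tendsto (fun r : ℝ => (r : ℂ) * Complex.exp (t * Complex.I)) Filter.atTop
      (Bornology.cobounded ℂ ⊓ Filter.principal (sector a b)) := by
  refine Filter.tendsto_inf.2 ⟨?_, Filter.tendsto_principal.2 ?_⟩
  · rw [← tendsto_norm_atTop_iff_cobounded]
    simp only [norm_mul, Complex.norm_exp_ofReal_mul_I, mul_one, Complex.norm_real, Real.norm_eq_abs]
    exact Filter.tendsto_abs_atTop_atTop
  · filter_upwards [Filter.eventually_gt_atTop 0] with r hr
    exact ⟨r, t, hr, ha, hb, rfl⟩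

/-- The midpoint plus and minus `π/2` both lie in the interval and point in opposite directions, so
one of them has a nonnegative real part against `c`. -/
theorem exists_re_nonneg_of_pi_lt {a b : ℝ} (hab : Real.pi < b - a) (c : ℂ) :
    ∃ t, a < t ∧ t < b ∧ 0 ≤ (Complex.exp (t * Complex.I) * c).re := by
  have hpi := Real.pi_pos
  set m := (a + b) / 2 with hm
  have h1 : Complex.exp (((m + Real.pi / 2 : ℝ) : ℂ) * Complex.I) =
      Complex.I * Complex.exp (m * Complex.I) := by
    rw [Complex.ofReal_add, add_mul, Complex.exp_add, mul_comm]
    push_cast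
    rw [Complex.exp_pi_div_two_mul_I]
  have h2 : Complex.exp (((m - Real.pi / 2 : ℝ) : ℂ) * Complex.I) =
      -(Complex.I * Complex.exp (m * Complex.I)) := by
    rw [Complex.ofReal_sub, sub_mul, sub_eq_add_neg, Complex.exp_add, mul_comm, ← neg_mul]
    push_cast
    rw [← neg_mul, neg_mul, Complex.exp_neg, Complex.exp_pi_div_two_mul_I, Complex.inv_I, neg_mul]
  rcases le_total 0 ((Complex.I * Complex.exp (m * Complex.I)) * c).re with h | h
  · exact ⟨m + Real.pi / 2, by linarith, by linarith, by rwa [h1]⟩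
  · refine ⟨m - Real.pi / 2, by linarith, by linarith, ?_⟩
    rw [h2, neg_mul, Complex.neg_re]
    linarith

end Sectors

/-! ### Uniqueness of formal and sectorial solutions at infinity. -/

section Uniqueness

variable {n : ℕ}

/-- Off the diagonal, equation `k` determines the entries of `P (k + 1)` after division by `u_b -
u_a`. On the diagonal the commutator with `U` vanishes, and equation `k + 1` gives `(k + 1) P_{aa}`
in terms of the off-diagonal entries of the same coefficient. -/
theorem formal_coefficients_unique {u : Fin n → ℂ} (hu : Function.Injective u)
    {V : Matrix (Fin n) (Fin n) ℂ} {P Q : ℕ → Matrix (Fin n) (Fin n) ℂ} (hP0 : P 0 = 1)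
    (hQ0 : Q 0 = 1)
    (hP : ∀ k : ℕ, -(k : ℂ) • P k + P (k + 1) * Matrix.diagonal u =
      Matrix.diagonal u * P (k + 1) + V * P k)
    (hQ : ∀ k : ℕ, -(k : ℂ) • Q k + Q (k + 1) * Matrix.diagonal u =
      Matrix.diagonal u * Q (k + 1) + V * Q k) (k : ℕ) : P k = Q k := by
  -- The diagonal of equation `0` with `P 0 = 1` forces this; otherwise the diagonal entry would
  -- occur on both sides of its own equation.
  have hV : ∀ a, V a a = 0 := by
    intro a
    have h := congrFun (congrFun (hP 0) a) a
    rw [hP0] at h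
    simp only [Nat.cast_zero, neg_zero, zero_smul, zero_add, mul_one, Matrix.add_apply, Matrix.zero_apply,
      Matrix.mul_diagonal, Matrix.diagonal_mul] at h
    linear_combination -h
  induction k with
  | zero => rw [hP0, hQ0]
  | succ k ih =>
    have hoff : ∀ a b, a ≠ b → P (k + 1) a b = Q (k + 1) a b := by
      intro a b hab
      have h1 := congrFun (congrFun (hP k) a) b
      have h2 := congrFun (congrFun (hQ k) a) b
      rw [ih] at h1
      simp only [Matrix.add_apply, Matrix.mul_diagonal, Matrix.diagonal_mul] at h1 h2
      have h3 : u b - u a ≠ 0 := sub_ne_zero.2 fun h => hab (hu h).symm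
      refine mul_right_cancel₀ h3 ?_
      linear_combination h1 - h2
    ext a b
    by_cases hab : a = b
    · subst hab
      have h1 := congrFun (congrFun (hP (k + 1)) a) a
      have h2 := congrFun (congrFun (hQ (k + 1)) a) a
      simp only [Matrix.add_apply, Matrix.mul_diagonal, Matrix.diagonal_mul, Matrix.smul_apply,
        smul_eq_mul] at h1 h2
      have h3 : (V * P (k + 1)) a a = (V * Q (k + 1)) a a := by
        simp only [Matrix.mul_apply]
        refine Finset.sum_congr rfl fun j _ => ?_
        by_cases hj : j = a
        · rw [hj, hV, zero_mul, zero_mul]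
        · rw [hoff j a hj]
      have h4 : ((k + 1 : ℕ) : ℂ) ≠ 0 := Nat.cast_ne_zero.2 (Nat.succ_ne_zero k)
      refine mul_left_cancel₀ h4 ?_
      linear_combination h2 - h1 - h3
    · exact hoff a b hab

theorem IsFormalSolution.unique {M : Type*} [TopologicalSpace M] [ChartedSpace (Fin n → ℂ) M]
    {B : Set M} {u : M → Fin n → ℂ} {V : M → Matrix (Fin n) (Fin n) ℂ}
    {Φ Φ' : ℕ → M → Matrix (Fin n) (Fin n) ℂ} (hΦ : IsFormalSolution B u V Φ)
    (hΦ' : IsFormalSolution B u V Φ') (k : ℕ) {p : M} (hp : p ∈ B)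
    (hu : Function.Injective (u p)) : Φ k p = Φ' k p :=
  formal_coefficients_unique (P := fun k => Φ k p) (Q := fun k => Φ' k p) hu (hΦ.zero p hp)
    (hΦ'.zero p hp) (fun k => hΦ.eq_z k p hp) (fun k => hΦ'.eq_z k p hp) k

theorem IsFormalSolution.congr {M : Type*} [TopologicalSpace M] [ChartedSpace (Fin n → ℂ) M]
    {B : Set M} {u : M → Fin n → ℂ} {V V' : M → Matrix (Fin n) (Fin n) ℂ}
    {Φ : ℕ → M → Matrix (Fin n) (Fin n) ℂ} (hΦ : IsFormalSolution B u V Φ)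
    (hV : ∀ p ∈ B, V p = V' p) : IsFormalSolution B u V' Φ where
  holomorphic := hΦ.holomorphic
  zero := hΦ.zero
  orthogonal := hΦ.orthogonal
  eq_u i k p hp := by rw [← hV p hp]; exact hΦ.eq_u i k p hp
  eq_z k p hp := by rw [← hV p hp]; exact hΦ.eq_z k p hp

variable {u : Fin n → ℂ} {V : Matrix (Fin n) (Fin n) ℂ} {Φ : ℕ → Matrix (Fin n) (Fin n) ℂ}

theorem IsSectorialSolution.mono {P Q : Set ℂ} {Y : ℂ → Matrix (Fin n) (Fin n) ℂ}
    (hY : IsSectorialSolution u V Φ P Y) (h : Q ⊆ P) : IsSectorialSolution u V Φ Q Y where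
  analytic a b := (hY.analytic a b).mono h
  eq_z z hz := hY.eq_z z (h hz)
  nonsingular z hz := hY.nonsingular z (h hz)
  asymptotic N a b := (hY.asymptotic N a b).mono
    (inf_le_inf_left _ (Filter.principal_mono.2 h))

theorem IsSectorialSolution.tendsto_one {P : Set ℂ} {Y : ℂ → Matrix (Fin n) (Fin n) ℂ}
    (hY : IsSectorialSolution u V Φ P Y) (hΦ : Φ 0 = 1) :
    Filter.Tendsto (fun z => Y z * Matrix.diagonal fun i => Complex.exp (-(z * u i)))
      (Bornology.cobounded ℂ ⊓ Filter.principal P) (𝓝 1) := by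
  refine tendsto_pi_nhds.2 fun a => tendsto_pi_nhds.2 fun b => ?_
  have h := hY.asymptotic 1 a b
  simp only [Finset.range_one, Finset.sum_singleton, pow_zero, mul_one, pow_one, hΦ] at h
  have h2 := h.trans_tendsto
    ((Filter.tendsto_inv₀_cobounded (α := ℂ)).mono_left inf_le_left)
  simpa using h2.add_const ((1 : Matrix (Fin n) (Fin n) ℂ) a b)

/-- A solution with prescribed asymptotics in a sector of opening greater than `π` is unique. -/
theorem IsSectorialSolution.unique {a b : ℝ} (hab : Real.pi < b - a)
    {Y Y' : ℂ → Matrix (Fin n) (Fin n) ℂ} (hΦ : Φ 0 = 1)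
    (hY : IsSectorialSolution u V Φ (sector a b) Y)
    (hY' : IsSectorialSolution u V Φ (sector a b) Y') {z : ℂ} (hz : z ∈ sector a b) :
    Y z = Y' z := by
  obtain ⟨T, hT⟩ := exists_eq_mul_of_linear_system (isOpen_sector a b) (isPreconnected_sector a b)
    (A := fun z => Matrix.diagonal u + z⁻¹ • V) hY.eq_z hY'.eq_z hY.nonsingular
  set F := Bornology.cobounded ℂ ⊓ Filter.principal (sector a b) with hF
  -- Both `Y e^{-zU}` and `Y T e^{-zU}` tend to `1`, hence so does their quotient `e^{zU} T
  -- e^{-zU}`.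
  have hlim : ∀ i j, Filter.Tendsto (fun z => T i j * Complex.exp (z * (u i - u j))) F
      (𝓝 ((1 : Matrix (Fin n) (Fin n) ℂ) i j)) := by
    have h1 := hY.tendsto_one hΦ
    have h2 := hY'.tendsto_one hΦ
    have h3 : Filter.Tendsto (fun z => (Y z * Matrix.diagonal fun i => Complex.exp (-(z * u i)))⁻¹ *
        (Y' z * Matrix.diagonal fun i => Complex.exp (-(z * u i)))) F
        (𝓝 ((1 : Matrix (Fin n) (Fin n) ℂ)⁻¹ * 1)) := by
      refine Filter.Tendsto.mul ?_ h2
      have hdet : ContinuousAt (fun A : Matrix (Fin n) (Fin n) ℂ => A⁻¹) 1 := by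
        simp only [Matrix.inv_def, Ring.inverse_eq_inv']
        exact ContinuousAt.smul (ContinuousAt.inv₀ (continuous_id.matrix_det.continuousAt) (by simp))
          continuous_id.matrix_adjugate.continuousAt
      exact hdet.tendsto.comp h1
    rw [inv_one, mul_one] at h3
    intro i j
    have h4 := tendsto_pi_nhds.1 (tendsto_pi_nhds.1 h3 i) j
    refine h4.congr' ?_
    have h5 : ∀ᶠ z in F, z ∈ sector a b := Filter.mem_inf_of_right (Filter.mem_principal_self _)
    filter_upwards [h5] with z hz
    have h6 : (Matrix.diagonal fun i => Complex.exp (-(z * u i)))⁻¹ =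
        Matrix.diagonal fun i => Complex.exp (z * u i) := by
      refine Matrix.inv_eq_left_inv ?_
      rw [Matrix.diagonal_mul_diagonal, ← Matrix.diagonal_one]
      congr 1
      ext i
      rw [← Complex.exp_add, add_neg_cancel, Complex.exp_zero]
    have h7 : (Y z * Matrix.diagonal fun i => Complex.exp (-(z * u i)))⁻¹ *
        (Y' z * Matrix.diagonal fun i => Complex.exp (-(z * u i))) =
        (Matrix.diagonal fun i => Complex.exp (z * u i)) * T *
          Matrix.diagonal fun i => Complex.exp (-(z * u i)) := by
      rw [hT z hz, Matrix.mul_inv_rev, h6, mul_assoc, mul_assoc,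
        Matrix.nonsing_inv_mul_cancel_left _ _ (hY.nonsingular z hz).isUnit, mul_assoc]
    rw [h7, Matrix.mul_diagonal, Matrix.diagonal_mul, mul_sub, sub_eq_add_neg, Complex.exp_add]
    ring
  have hT1 : T = 1 := by
    ext i j
    -- The opening exceeds `π`, so some ray of the sector has `|e^{z(u_i - u_j)}| ≥ 1`. Off the
    -- diagonal the product with `T i j` still tends to `0`, hence `T i j = 0`.
    obtain ⟨t, ha, hb, ht⟩ := exists_re_nonneg_of_pi_lt hab (u i - u j)
    have h1 := (hlim i j).comp (tendsto_ray ha hb)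
    by_cases hij : i = j
    · subst hij
      refine tendsto_nhds_unique ?_ h1
      simp [Function.comp_def]
    · rw [Matrix.one_apply_ne hij] at h1 ⊢
      have h2 : Filter.Tendsto (fun _ : ℝ => T i j) Filter.atTop (𝓝 0) := by
        refine squeeze_zero_norm' ?_ (tendsto_zero_iff_norm_tendsto_zero.1 h1)
        filter_upwards [Filter.eventually_ge_atTop 0] with r hr
        simp only [Function.comp_apply, norm_mul, Complex.norm_exp]
        refine le_mul_of_one_le_right (norm_nonneg _) (Real.one_le_exp ?_)
        rw [mul_assoc, Complex.re_ofReal_mul]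
        exact mul_nonneg hr ht
      exact tendsto_nhds_unique tendsto_const_nhds h2
  rw [hT z hz, hT1, mul_one]

end Uniqueness

/-! ### Structure functions and the Euler field in a flat chart. -/

section FrobeniusGeometry

variable {n : ℕ} {M : Type*} [TopologicalSpace M] [ChartedSpace (Fin n → ℂ) M]

/-- Passes from partial derivatives to one complex variable, the setting of the eigenvalue
perturbation lemma. -/
theorem hasDerivAt_coordinate_line {v : OpenPartialHomeomorph M (Fin n → ℂ)}
    (hv : v ∈ IsManifold.maximalAtlas 𝓘(ℂ, Fin n → ℂ) ω M) {f : M → ℂ}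
    (hf : IsHolomorphicOn n v.source f) {p : M} (hp : p ∈ v.source) (β : Fin n) :
    HasDerivAt (fun t : ℂ => f (v.symm (v p + t • Pi.single β 1))) (coordDeriv v β f p) 0 := by
  obtain ⟨h1, h2⟩ := dirDeriv_eq_fderiv hv hp (hf.mdifferentiableAt v.open_source hp)
    (coordVec v p β)
  rw [dCoord_coordVec (dCoord_chart_isInvertible hv hp)] at h2
  have h3 : HasDerivAt (fun t : ℂ => v p + t • (Pi.single β 1 : Fin n → ℂ)) (Pi.single β 1) 0 := by
    simpa using ((hasDerivAt_id (0 : ℂ)).smul_const (Pi.single β 1 : Fin n → ℂ)).const_add (v p)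
  have h4 : HasFDerivAt (f ∘ v.symm) (fderiv ℂ (f ∘ v.symm) (v p))
      (v p + (0 : ℂ) • (Pi.single β 1 : Fin n → ℂ)) := by
    simpa using h1.hasFDerivAt
  have h5 := h4.comp_hasDerivAt (0 : ℂ) h3
  rw [coordDeriv, h2]
  exact h5

namespace FrobeniusData

/-- The matrix of the multiplication by `X` in the coordinates `w`. -/
def mulMatrix (F : FrobeniusData n M) (w : M → Fin n → ℂ) (p : M)
    (X : TangentSpace 𝓘(ℂ, Fin n → ℂ) p) : Matrix (Fin n) (Fin n) ℂ :=
  Matrix.of fun α β => dCoord w p (F.mul p X (coordVec w p β)) α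

theorem mulMatrix_mulVec (F : FrobeniusData n M) {w : M → Fin n → ℂ} {p : M}
    (hw : (dCoord w p).IsInvertible) (X Y : TangentSpace 𝓘(ℂ, Fin n → ℂ) p) :
    (F.mulMatrix w p X).mulVec (dCoord w p Y) = dCoord w p (F.mul p X Y) := by
  conv_rhs => rw [eq_sum_coordVec hw Y]
  ext α
  simp only [map_sum, map_smul, Matrix.mulVec, dotProduct, mulMatrix, Matrix.of_apply,
    Finset.sum_apply, Pi.smul_apply, smul_eq_mul]
  exact Finset.sum_congr rfl fun β _ => mul_comm _ _

theorem mulMatrix_eq_sum (F : FrobeniusData n M) {w : M → Fin n → ℂ} {p : M}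
    (hw : (dCoord w p).IsInvertible) (X : TangentSpace 𝓘(ℂ, Fin n → ℂ) p) :
    F.mulMatrix w p X = ∑ ρ, dCoord w p X ρ • F.mulMatrix w p (coordVec w p ρ) := by
  ext α β
  simp only [mulMatrix, Matrix.of_apply, Matrix.sum_apply, Matrix.smul_apply, smul_eq_mul]
  conv_lhs => rw [eq_sum_coordVec hw X]
  simp only [map_sum, map_smul, LinearMap.sum_apply, LinearMap.smul_apply, Finset.sum_apply,
    Pi.smul_apply, smul_eq_mul]

theorem eulerMul_eq_mulMatrix (F : FrobeniusData n M) {w : M → Fin n → ℂ} {p : M}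
    (hw : (dCoord w p).IsInvertible) : F.eulerMul w p = F.mulMatrix w p (F.euler p) := by
  rw [mulMatrix_eq_sum F hw]
  ext α β
  simp [eulerMul, eulerComp, mulMatrix, cUp, Matrix.sum_apply]

theorem eulerMul_apply (F : FrobeniusData n M) {w : M → Fin n → ℂ} {p : M}
    (hw : (dCoord w p).IsInvertible) (α β : Fin n) :
    F.eulerMul w p α β = dCoord w p (F.mul p (F.euler p) (coordVec w p β)) α := by
  rw [eulerMul_eq_mulMatrix F hw]
  rfl

theorem metric_coordVec_right (F : FrobeniusData n M) {w : M → Fin n → ℂ} {p : M}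
    (hw : (dCoord w p).IsInvertible) (X : TangentSpace 𝓘(ℂ, Fin n → ℂ) p) (β : Fin n) :
    F.metric p X (coordVec w p β) = ∑ α, dCoord w p X α * F.gram w p α β := by
  conv_lhs => rw [eq_sum_coordVec hw X]
  simp [gram, LinearMap.sum_apply]

theorem cLow_eq_sum (F : FrobeniusData n M) {w : M → Fin n → ℂ} {p : M}
    (hw : (dCoord w p).IsInvertible) (α β γ : Fin n) :
    F.cLow w α β γ p = ∑ δ, F.cUp w δ α β p * F.gram w p δ γ :=
  metric_coordVec_right F hw _ γ

theorem IsAdaptedFlatChart.dCoord_euler {F : FrobeniusData n M}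
    {v : OpenPartialHomeomorph M (Fin n → ℂ)} {ι : Fin n} {μ r : Fin n → ℂ} (hv : F.IsAdaptedFlatChart v ι μ r) {p : M}
    (hp : p ∈ v.source) (α : Fin n) :
    dCoord v p (F.euler p) α = (1 - F.charge / 2 - μ α) * v p α + r α := by
  rw [(hv.2 p hp).2]
  simp [map_sum, dCoord_coordVec (dCoord_chart_isInvertible hv.1.1 hp), Finset.sum_apply,
    Pi.single_apply]

theorem IsAdaptedFlatChart.isHolomorphicOn_euler {F : FrobeniusData n M}
    {v : OpenPartialHomeomorph M (Fin n → ℂ)} {ι : Fin n} {μ r : Fin n → ℂ}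
    (hv : F.IsAdaptedFlatChart v ι μ r) (α : Fin n) :
    IsHolomorphicOn n v.source (fun q => dCoord v q (F.euler q) α) := by
  exact ContMDiffOn.congr (ContMDiffOn.add
    ((contMDiffOn_const (c := 1 - F.charge / 2 - μ α)).mul (isHolomorphicOn_chart_apply hv.1.1 α))
    (contMDiffOn_const (c := r α))) fun q hq => hv.dCoord_euler hq α

theorem IsAdaptedFlatChart.dirDeriv_euler {F : FrobeniusData n M}
    {v : OpenPartialHomeomorph M (Fin n → ℂ)} {ι : Fin n} {μ r : Fin n → ℂ}
    (hv : F.IsAdaptedFlatChart v ι μ r) {p : M}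
    (hp : p ∈ v.source) (α : Fin n) (X : TangentSpace 𝓘(ℂ, Fin n → ℂ) p) :
    dirDeriv (fun q => dCoord v q (F.euler q) α) p X =
      (1 - F.charge / 2 - μ α) * dCoord v p X α := by
  have h : (fun q => dCoord v q (F.euler q) α) =ᶠ[𝓝 p]
      fun q => (1 - F.charge / 2 - μ α) * v q α + r α := by
    filter_upwards [v.open_source.mem_nhds hp] with q hq
    exact hv.dCoord_euler hq α
  have hd : ∀ i, MDifferentiableAt 𝓘(ℂ, Fin n → ℂ) 𝓘(ℂ, ℂ) (fun q => v q i) p := fun i =>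
    (isHolomorphicOn_chart_apply hv.1.1 i).mdifferentiableAt v.open_source hp
  rw [dirDeriv_congr h, dirDeriv_add (f := fun q => (1 - F.charge / 2 - μ α) * v q α)
    (mdifferentiableAt_const.mul (hd α)) mdifferentiableAt_const,
    dirDeriv_const_mul _ (hd α), dirDeriv_const, add_zero, dCoord_apply hd]

variable [IsManifold 𝓘(ℂ, Fin n → ℂ) ω M] {F : FrobeniusData n M}

theorem IsFrobenius.gram_symm (hF : F.IsFrobenius) (w : M → Fin n → ℂ) (p : M) (α β : Fin n) :
    F.gram w p α β = F.gram w p β α :=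
  hF.metric_symm p _ _

/-- A null vector of the Gram matrix would be the coordinates of a tangent vector orthogonal to
everything. -/
theorem IsFrobenius.isUnit_det_gram (hF : F.IsFrobenius) {w : M → Fin n → ℂ} {p : M}
    (hw : (dCoord w p).IsInvertible) : IsUnit (F.gram w p).det := by
  rw [isUnit_iff_ne_zero]
  intro h0
  obtain ⟨x, hx, hx0⟩ := Matrix.exists_vecMul_eq_zero_iff.2 h0
  obtain ⟨T, hT⟩ := id hw
  have hTx : dCoord w p (T.symm x) = x := by rw [← hT]; exact T.apply_symm_apply x
  have h1 : T.symm x = 0 := by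
    refine hF.metric_nondegenerate p _ fun y => ?_
    rw [eq_sum_coordVec hw y, map_sum]
    refine Finset.sum_eq_zero fun β _ => ?_
    rw [map_smul, metric_coordVec_right F hw, hTx]
    have := congrFun hx0 β
    simp only [Matrix.vecMul, dotProduct, Pi.zero_apply] at this
    rw [this, smul_zero]
  apply hx
  rw [← hTx, h1, map_zero]

theorem IsFrobenius.cUp_eq_sum (hF : F.IsFrobenius) {w : M → Fin n → ℂ} {p : M}
    (hw : (dCoord w p).IsInvertible) (γ α β : Fin n) :
    F.cUp w γ α β p = ∑ δ, (F.gram w p)⁻¹ δ γ * F.cLow w α β δ p := by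
  have h : Matrix.vecMul (Matrix.vecMul (fun δ => F.cUp w δ α β p) (F.gram w p)) (F.gram w p)⁻¹ =
      fun δ => F.cUp w δ α β p := by
    rw [Matrix.vecMul_vecMul, Matrix.mul_nonsing_inv _ (hF.isUnit_det_gram hw), Matrix.vecMul_one]
  rw [← congrFun h γ]
  simp only [Matrix.vecMul, dotProduct]
  refine Finset.sum_congr rfl fun δ _ => ?_
  rw [cLow_eq_sum F hw]
  exact _root_.mul_comm _ _

section FlatChart

variable {v : OpenPartialHomeomorph M (Fin n → ℂ)}

theorem isHolomorphicField_coordVec (hv : v ∈ IsManifold.maximalAtlas 𝓘(ℂ, Fin n → ℂ) ω M)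
    (α : Fin n) : IsHolomorphicField v.source (fun q => coordVec v q α) := by
  refine isHolomorphicField_of_components hv fun i => ?_
  refine ContMDiffOn.congr (contMDiffOn_const (c := (Pi.single α 1 : Fin n → ℂ) i)) fun q hq => ?_
  rw [dCoord_coordVec (dCoord_chart_isInvertible hv hq)]

theorem IsFrobenius.isHolomorphicOn_cLow (hF : F.IsFrobenius)
    (hv : v ∈ IsManifold.maximalAtlas 𝓘(ℂ, Fin n → ℂ) ω M) (α β γ : Fin n) :
    IsHolomorphicOn n v.source (F.cLow v α β γ) :=
  hF.holomorphic_metric _ v.open_source _ _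
    (hF.holomorphic_mul _ v.open_source _ _ (isHolomorphicField_coordVec hv α)
      (isHolomorphicField_coordVec hv β)) (isHolomorphicField_coordVec hv γ)

/-- With the Gram matrix frozen at `p`, the coefficients do not depend on `q`, so holomorphy and the
symmetry of `∇c` pass to the raised tensor. -/
theorem IsFrobenius.cUp_eq_sum_of_isFlatChart (hF : F.IsFrobenius) (hv : F.IsFlatChart v) {p q : M}
    (hp : p ∈ v.source) (hq : q ∈ v.source) (γ α β : Fin n) :
    F.cUp v γ α β q = ∑ δ, (F.gram v p)⁻¹ δ γ * F.cLow v α β δ q := by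
  rw [hv.2 p hp q hq]
  exact hF.cUp_eq_sum (dCoord_chart_isInvertible hv.1 hq) γ α β

theorem IsFrobenius.isHolomorphicOn_cUp (hF : F.IsFrobenius) (hv : F.IsFlatChart v)
    (γ α β : Fin n) : IsHolomorphicOn n v.source (F.cUp v γ α β) := by
  intro p hp
  exact (ContMDiffOn.congr (IsHolomorphicOn.sum_const_mul Finset.univ
    (fun δ => (F.gram v p)⁻¹ δ γ) fun δ _ => hF.isHolomorphicOn_cLow hv.1 α β δ)
    fun q hq => hF.cUp_eq_sum_of_isFlatChart hv hp hq γ α β) p hp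

theorem IsFrobenius.coordDeriv_cUp_symm (hF : F.IsFrobenius) (hv : F.IsFlatChart v) {p : M}
    (hp : p ∈ v.source) (α β γ δ : Fin n) :
    coordDeriv v δ (F.cUp v γ α β) p = coordDeriv v α (F.cUp v γ δ β) p := by
  have key : ∀ α δ, coordDeriv v δ (F.cUp v γ α β) p =
      ∑ ε, (F.gram v p)⁻¹ ε γ * coordDeriv v δ (F.cLow v α β ε) p := by
    intro α δ
    have h : F.cUp v γ α β =ᶠ[𝓝 p] fun q => ∑ ε, (F.gram v p)⁻¹ ε γ * F.cLow v α β ε q := by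
      filter_upwards [v.open_source.mem_nhds hp] with q hq
      exact hF.cUp_eq_sum_of_isFlatChart hv hp hq γ α β
    rw [coordDeriv, dirDeriv_congr h, dirDeriv_sum_const_mul]
    · rfl
    · exact fun ε _ => (hF.isHolomorphicOn_cLow hv.1 α β ε).mdifferentiableAt v.open_source hp
  rw [key, key]
  exact Finset.sum_congr rfl fun ε _ => by rw [hF.nabla_c_symm v hv p hp]

variable {ι : Fin n} {μ r : Fin n → ℂ}

theorem IsAdaptedFlatChart.mlieBracket_euler_coordVec (hv : F.IsAdaptedFlatChart v ι μ r) {p : M}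
    (hp : p ∈ v.source) (α : Fin n) :
    VectorField.mlieBracket 𝓘(ℂ, Fin n → ℂ) F.euler (fun q => coordVec v q α) p =
      -(1 - F.charge / 2 - μ α) • coordVec v p α := by
  have hc : ∀ i, ∀ q ∈ v.source,
      dCoord v q (coordVec v q α) i = (Pi.single α 1 : Fin n → ℂ) i := fun i q hq => by
    rw [dCoord_coordVec (dCoord_chart_isInvertible hv.1.1 hq)]
  apply dCoord_injective (dCoord_chart_isInvertible hv.1.1 hp)
  ext i
  rw [dCoord_mlieBracket hv.1.1 hp hv.isHolomorphicOn_euler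
    (fun i => ContMDiffOn.congr contMDiffOn_const (hc i)), hv.dirDeriv_euler hp, map_smul]
  have h : (fun q => dCoord v q (coordVec v q α) i) =ᶠ[𝓝 p]
      fun _ => (Pi.single α 1 : Fin n → ℂ) i := by
    filter_upwards [v.open_source.mem_nhds hp] with q hq using hc i q hq
  rw [dirDeriv_congr h, dirDeriv_const, zero_sub, Pi.smul_apply, hc i p hp, smul_eq_mul,
    Pi.single_apply]
  split_ifs with hi
  · rw [hi]; ring
  · simp

/-- This is the `γ` component of the Euler axiom for `∂_α` and `∂_β`, since `[E, ∂_α] = -(1 - D/2 -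
μ_α) ∂_α`. -/
theorem IsFrobenius.dirDeriv_cUp_euler (hF : F.IsFrobenius) (hv : F.IsAdaptedFlatChart v ι μ r)
    {p : M} (hp : p ∈ v.source) (γ α β : Fin n) :
    dirDeriv (F.cUp v γ α β) p (F.euler p) =
      (F.charge / 2 - μ γ + μ α + μ β) * F.cUp v γ α β p := by
  have h := hF.euler_mul v.source v.open_source _ _ (isHolomorphicField_coordVec hv.1.1 α)
    (isHolomorphicField_coordVec hv.1.1 β) p hp
  rw [hv.mlieBracket_euler_coordVec hp, hv.mlieBracket_euler_coordVec hp] at h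
  have h2 := congrArg (fun X => dCoord v p X γ) h
  simp only [map_sub, map_smul, LinearMap.smul_apply, Pi.sub_apply, Pi.smul_apply,
    smul_eq_mul] at h2
  rw [dCoord_mlieBracket hv.1.1 hp hv.isHolomorphicOn_euler
    (fun i => hF.isHolomorphicOn_cUp hv.1 i α β), hv.dirDeriv_euler hp] at h2
  have h3 : dirDeriv (fun q => dCoord v q (F.mul q (coordVec v q α) (coordVec v q β)) γ) p
      (F.euler p) = dirDeriv (F.cUp v γ α β) p (F.euler p) := rfl
  have h4 : dCoord v p (F.mul p (coordVec v p α) (coordVec v p β)) γ = F.cUp v γ α β p := rfl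
  rw [h3, h4] at h2
  linear_combination h2

/-- The derivative of the multiplication by `E` is `∂_β 𝓤 = C_β + [C_β, μ]`. -/
theorem IsFrobenius.coordDeriv_eulerMul (hF : F.IsFrobenius) (hv : F.IsAdaptedFlatChart v ι μ r)
    {p : M} (hp : p ∈ v.source) (α γ β : Fin n) :
    coordDeriv v β (fun q => F.eulerMul v q α γ) p = (1 - μ α + μ γ) * F.cUp v α β γ p := by
  have hinv := dCoord_chart_isInvertible hv.1.1 hp
  have hE : ∀ ρ, MDifferentiableAt 𝓘(ℂ, Fin n → ℂ) 𝓘(ℂ, ℂ)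
      (fun q => dCoord v q (F.euler q) ρ) p := fun ρ =>
    (hv.isHolomorphicOn_euler ρ).mdifferentiableAt v.open_source hp
  have hC : ∀ ρ, MDifferentiableAt 𝓘(ℂ, Fin n → ℂ) 𝓘(ℂ, ℂ) (F.cUp v α ρ γ) p := fun ρ =>
    (hF.isHolomorphicOn_cUp hv.1 α ρ γ).mdifferentiableAt v.open_source hp
  have h1 : coordDeriv v β (fun q => F.eulerMul v q α γ) p =
      ∑ ρ, dirDeriv (fun q => dCoord v q (F.euler q) ρ * F.cUp v α ρ γ q) p (coordVec v p β) :=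
    (dirDeriv_sum Finset.univ (fun ρ _ => (hE ρ).mul (hC ρ)) _).2
  -- The symmetry of `∇c` exchanges `β` and `ρ`, so the first terms sum to the derivative of
  -- `c^α_{βγ}` along `E`, which homogeneity evaluates.
  have h2 : ∀ ρ, dirDeriv (fun q => dCoord v q (F.euler q) ρ * F.cUp v α ρ γ q) p
      (coordVec v p β) = dCoord v p (F.euler p) ρ * coordDeriv v ρ (F.cUp v α β γ) p +
        F.cUp v α ρ γ p * ((1 - F.charge / 2 - μ ρ) * (Pi.single β 1 : Fin n → ℂ) ρ) := fun ρ => by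
    rw [dirDeriv_mul (hE ρ) (hC ρ), hv.dirDeriv_euler hp, dCoord_coordVec hinv,
      ← hF.coordDeriv_cUp_symm hv.1 hp]
    rfl
  rw [h1, Finset.sum_congr rfl fun ρ _ => h2 ρ, Finset.sum_add_distrib,
    ← dirDeriv_eq_sum hinv, hF.dirDeriv_cUp_euler hv hp]
  simp only [Pi.single_apply, mul_ite, mul_one, mul_zero, Finset.sum_ite_eq', Finset.mem_univ,
    if_true]
  ring

theorem IsFrobenius.isHolomorphicOn_eulerMul (hF : F.IsFrobenius)
    (hv : F.IsAdaptedFlatChart v ι μ r) (α γ : Fin n) :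
    IsHolomorphicOn n v.source (fun q => F.eulerMul v q α γ) :=
  contMDiffOn_finsetSum (t := Finset.univ) (f := fun ρ q => F.eulerComp v ρ q * F.cUp v α ρ γ q)
    fun ρ _ => (hv.isHolomorphicOn_euler ρ).mul (hF.isHolomorphicOn_cUp hv.1 α ρ γ)

end FlatChart

end FrobeniusData
end FrobeniusGeometry

/-! ### Canonical coordinates: from eigenvalues of `E ·` to idempotents. -/

section CanonicalCoordinates

variable {n : ℕ} {M : Type*} [TopologicalSpace M] [ChartedSpace (Fin n → ℂ) M]
  [IsManifold 𝓘(ℂ, Fin n → ℂ) ω M]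

namespace FrobeniusData

variable {F : FrobeniusData n M} {v : OpenPartialHomeomorph M (Fin n → ℂ)} {ι : Fin n}
  {μ r : Fin n → ℂ} {u : M → Fin n → ℂ}

/-- The eigenlines of `E ·` are those of every multiplication, and the eigenvalues of `X ·` are the
derivatives `X(u_i)`. -/
theorem IsCanonicalCoordinates.exists_eigenbasis (hu : F.IsCanonicalCoordinates v.source v u)
    (hF : F.IsFrobenius) (hv : F.IsAdaptedFlatChart v ι μ r) {p : M} (hp : p ∈ v.source) :
    ∃ b : Module.Basis (Fin n) ℂ (Fin n → ℂ), ∀ (X : TangentSpace 𝓘(ℂ, Fin n → ℂ) p) (i : Fin n),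
      (F.mulMatrix v p X).mulVec (b i) = dCoord u p X i • b i := by
  have hinv := dCoord_chart_isInvertible hv.1.1 hp
  obtain ⟨b, hb⟩ := _root_.exists_eigenbasis (hu.eigenvalues p hp) (hu.distinct p hp)
  have hbasic : ∀ β i, (F.mulMatrix v p (coordVec v p β)).mulVec (b i) =
      coordDeriv v β (fun q => u q i) p • b i := by
    intro β i
    have h0 : v.symm (v p + (0 : ℂ) • (Pi.single β 1 : Fin n → ℂ)) = p := by
      simp [v.left_inv hp]
    have hC : F.mulMatrix v p (coordVec v p β) * F.eulerMul v p =
        F.eulerMul v p * F.mulMatrix v p (coordVec v p β) := by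
      rw [eulerMul_eq_mulMatrix F hinv]
      refine Matrix.ext_of_mulVec_single fun γ => ?_
      rw [← Matrix.mulVec_mulVec, ← Matrix.mulVec_mulVec, ← dCoord_coordVec hinv γ,
        mulMatrix_mulVec F hinv, mulMatrix_mulVec F hinv, mulMatrix_mulVec F hinv,
        mulMatrix_mulVec F hinv, ← hF.mul_assoc, ← hF.mul_assoc,
        hF.mul_comm p (coordVec v p β) (F.euler p)]
    -- Along the `v^β` line, `𝓤' = C + [A, C]` with `C` the multiplication by `∂_β` and `A =
    -- -diag(μ)`.
    refine mulVec_eigenvector_of_deriv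
      (U := fun t => F.eulerMul v (v.symm (v p + t • (Pi.single β 1 : Fin n → ℂ))))
      (u := fun t => u (v.symm (v p + t • (Pi.single β 1 : Fin n → ℂ))))
      (A := -Matrix.diagonal μ) (u' := fun i => coordDeriv v β (fun q => u q i) p)
      ?_ ?_ ?_ ?_ ?_ ?_ i
    · intro α γ
      have h := hasDerivAt_coordinate_line hv.1.1 (hF.isHolomorphicOn_eulerMul hv α γ) hp β
      rw [hF.coordDeriv_eulerMul hv hp] at h
      convert h using 1
      simp only [Matrix.sub_apply, Matrix.add_apply, Matrix.neg_mul, Matrix.mul_neg,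
        Matrix.neg_apply, Matrix.diagonal_mul, Matrix.mul_diagonal, mulMatrix, Matrix.of_apply, cUp]
      ring
    · exact fun i => hasDerivAt_coordinate_line hv.1.1 (hu.holomorphic i) hp β
    · have hcont : ContinuousAt (fun t : ℂ => v.symm (v p + t • (Pi.single β 1 : Fin n → ℂ))) 0 := by
        have h1 : ContinuousAt (fun t : ℂ => v p + t • (Pi.single β 1 : Fin n → ℂ)) 0 := by
          fun_prop
        refine ContinuousAt.comp (f := fun t : ℂ => v p + t • (Pi.single β 1 : Fin n → ℂ)) ?_ h1
        refine v.continuousAt_symm ?_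
        simpa using v.map_source hp
      have hmem := hcont.eventually_mem (s := v.source) (by rw [h0]; exact v.open_source.mem_nhds hp)
      filter_upwards [hmem] with t ht
      exact hu.eigenvalues _ ht
    · simp only [h0]
      exact hu.distinct p hp
    · simp only [h0]
      exact hC
    · simp only [h0]
      exact hb
  refine ⟨b, fun X i => ?_⟩
  rw [mulMatrix_eq_sum F hinv, Matrix.sum_mulVec, dCoord_apply
    (fun i => (hu.holomorphic i).mdifferentiableAt v.open_source hp), dirDeriv_eq_sum hinv,
    Finset.sum_smul]
  refine Finset.sum_congr rfl fun β _ => ?_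
  rw [Matrix.smul_mulVec, hbasic, smul_smul]

/-- The differential of the canonical coordinates is multiplicative. -/
theorem IsCanonicalCoordinates.dCoord_mul (hu : F.IsCanonicalCoordinates v.source v u)
    (hF : F.IsFrobenius) (hv : F.IsAdaptedFlatChart v ι μ r) {p : M} (hp : p ∈ v.source)
    (X Y : TangentSpace 𝓘(ℂ, Fin n → ℂ) p) (i : Fin n) :
    dCoord u p (F.mul p X Y) i = dCoord u p X i * dCoord u p Y i := by
  have hinv := dCoord_chart_isInvertible hv.1.1 hp
  obtain ⟨b, hb⟩ := hu.exists_eigenbasis hF hv hp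
  obtain ⟨T, hT⟩ := id hinv
  have hZ : dCoord v p (T.symm (b i)) = b i := by rw [← hT]; exact T.apply_symm_apply _
  -- Writing `b i` as the coordinates of a tangent vector turns associativity into multiplicativity
  -- of the eigenvalues.
  have h : dCoord u p (F.mul p X Y) i • b i = (dCoord u p X i * dCoord u p Y i) • b i := by
    rw [← hb, _root_.mul_comm, mul_smul, ← hb X, ← Matrix.mulVec_smul, ← hb Y, ← hZ,
      mulMatrix_mulVec F hinv, mulMatrix_mulVec F hinv, mulMatrix_mulVec F hinv, hF.mul_assoc]
  exact smul_left_injective ℂ (b.ne_zero i) h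

/-- Canonical coordinates are local coordinates. -/
theorem IsCanonicalCoordinates.dCoord_isInvertible (hu : F.IsCanonicalCoordinates v.source v u)
    (hF : F.IsFrobenius) (hv : F.IsAdaptedFlatChart v ι μ r) {p : M} (hp : p ∈ v.source) :
    (dCoord u p).IsInvertible := by
  have hinv := dCoord_chart_isInvertible hv.1.1 hp
  obtain ⟨b, hb⟩ := hu.exists_eigenbasis hF hv hp
  -- If `du(X) = 0`, multiplication by `X` kills an eigenbasis, hence also the unit, and `X = X · e
  -- = 0`.
  refine dCoord_isInvertible_of_injective ((injective_iff_map_eq_zero _).2 fun X hX => ?_)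
  · have h1 : (F.mulMatrix v p X).mulVecLin = 0 := by
      refine b.ext fun i => ?_
      rw [Matrix.mulVecLin_apply, hb, hX]
      simp
    have h2 := mulMatrix_mulVec F hinv X (F.unit p)
    rw [hF.mul_comm, hF.unit_mul] at h2
    have h3 := congrArg (fun f : (Fin n → ℂ) →ₗ[ℂ] (Fin n → ℂ) => f (dCoord v p (F.unit p))) h1
    simp only [Matrix.mulVecLin_apply, LinearMap.zero_apply] at h3
    rw [h2] at h3
    exact dCoord_injective hinv (by rw [h3, map_zero])

end FrobeniusData

end CanonicalCoordinates

/-! ### The transformed structure `S_κ(M)`. -/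

section Legendre

variable {n : ℕ} {M : Type*} [TopologicalSpace M] [ChartedSpace (Fin n → ℂ) M]

namespace FrobeniusData

variable {F : FrobeniusData n M} {v : OpenPartialHomeomorph M (Fin n → ℂ)} {ι : Fin n}
  {μ r : Fin n → ℂ} {R : Matrix (Fin n) (Fin n) ℂ} {θ : Fin n → ℕ → M → ℂ} {κ : Fin n}

theorem IsCalibration.dirDeriv_zero (hθ : F.IsCalibration v.source v ι μ R θ)
    (hv : F.IsFlatChart v) {p : M} (hp : p ∈ v.source) (α : Fin n)
    (X : TangentSpace 𝓘(ℂ, Fin n → ℂ) p) :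
    dirDeriv (θ α 0) p X = ∑ ρ, F.gram v p α ρ * dCoord v p X ρ := by
  have hd : ∀ i, MDifferentiableAt 𝓘(ℂ, Fin n → ℂ) 𝓘(ℂ, ℂ) (fun q => v q i) p := fun i =>
    (isHolomorphicOn_chart_apply hv.1 i).mdifferentiableAt v.open_source hp
  have h : θ α 0 =ᶠ[𝓝 p] fun q => ∑ ρ, F.gram v p α ρ * v q ρ := by
    filter_upwards [v.open_source.mem_nhds hp] with q hq
    rw [hθ.zero α q hq, hv.2 p hp q hq]
  rw [dirDeriv_congr h, dirDeriv_sum_const_mul _ _ fun ρ _ => hd ρ]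
  exact Finset.sum_congr rfl fun ρ _ => by rw [dCoord_apply hd]

theorem legendreCoord_eq (hv : F.IsFlatChart v) {p q : M} (hp : p ∈ v.source) (hq : q ∈ v.source)
    (α : Fin n) : F.legendreCoord v θ κ q α =
      ∑ β, (F.gram v p)⁻¹ α β * F.legendreCalibration v θ κ β 0 q := by
  rw [hv.2 p hp q hq]
  rfl

theorem IsAdaptedFlatChart.gradingMatrix_eq (hv : F.IsAdaptedFlatChart v ι μ r) {p : M}
    (hp : p ∈ v.source) : F.gradingMatrix v p = Matrix.diagonal μ := by
  ext α β
  have h : coordDeriv v β (F.eulerComp v α) p =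
      (1 - F.charge / 2 - μ α) * (Pi.single β 1 : Fin n → ℂ) α := by
    rw [← dCoord_coordVec (dCoord_chart_isInvertible hv.1.1 hp) β]
    exact hv.dirDeriv_euler hp α _
  simp only [gradingMatrix, Matrix.sub_apply, Matrix.smul_apply, Matrix.of_apply, h, smul_eq_mul,
    Matrix.one_apply, Matrix.diagonal_apply, Pi.single_apply]
  split_ifs
  · ring
  · ring

variable [IsManifold 𝓘(ℂ, Fin n → ℂ) ω M]

theorem IsFrobenius.dirDeriv_eulerMul (hF : F.IsFrobenius) (hv : F.IsAdaptedFlatChart v ι μ r)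
    {p : M} (hp : p ∈ v.source) (α γ : Fin n) (X : TangentSpace 𝓘(ℂ, Fin n → ℂ) p) :
    dirDeriv (fun q => F.eulerMul v q α γ) p X =
      (1 - μ α + μ γ) * dCoord v p (F.mul p (coordVec v p γ) X) α := by
  have hinv := dCoord_chart_isInvertible hv.1.1 hp
  rw [dirDeriv_eq_sum hinv, ← mulMatrix_mulVec F hinv, Matrix.mulVec, dotProduct, Finset.mul_sum]
  refine Finset.sum_congr rfl fun β _ => ?_
  rw [hF.coordDeriv_eulerMul hv hp, mulMatrix, Matrix.of_apply, hF.mul_comm p (coordVec v p γ), cUp]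
  ring

/-- Only one term of the division survives for second index `0`, and the gradient of `θ_{κ,0} = ∑
η_{κρ} v^ρ` is `∂_κ`. -/
theorem IsCalibration.twoPoint_zero (hθ : F.IsCalibration v.source v ι μ R θ)
    (hF : F.IsFrobenius) (hv : F.IsFlatChart v) {p : M} (hp : p ∈ v.source) (α : Fin n) (m : ℕ) :
    F.twoPoint v θ α m κ 0 p = coordDeriv v κ (θ α (m + 1)) p := by
  have hinv := dCoord_chart_isInvertible hv.1 hp
  have h1 : ∀ σ, coordDeriv v σ (θ κ 0) p = F.gram v p σ κ := by
    intro σ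
    rw [coordDeriv, hθ.dirDeriv_zero hv hp, dCoord_coordVec hinv, hF.gram_symm v p σ κ]
    simp [Pi.single_apply]
  simp only [twoPoint, zero_add, Finset.range_one, Finset.sum_singleton, pow_zero, one_mul,
    add_zero, Nat.sub_zero, gradPair, h1]
  have h2 : ∀ ρ, ∑ σ, (F.gram v p)⁻¹ ρ σ * coordDeriv v ρ (θ α (m + 1)) p * F.gram v p σ κ =
      (1 : Matrix (Fin n) (Fin n) ℂ) ρ κ * coordDeriv v ρ (θ α (m + 1)) p := by
    intro ρ
    rw [← Matrix.nonsing_inv_mul _ (hF.isUnit_det_gram hinv), Matrix.mul_apply, Finset.sum_mul]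
    exact Finset.sum_congr rfl fun σ _ => by ring
  simp [Finset.sum_congr rfl fun ρ _ => h2 ρ, Matrix.one_apply]

theorem IsCalibration.isHolomorphicOn_legendreCalibration
    (hθ : F.IsCalibration v.source v ι μ R θ) (hF : F.IsFrobenius) (hv : F.IsFlatChart v)
    (α : Fin n) (m : ℕ) : IsHolomorphicOn n v.source (F.legendreCalibration v θ κ α m) :=
  ContMDiffOn.congr (IsHolomorphicOn.coordDeriv hv.1 (hθ.holomorphic α (m + 1)) κ) fun _ hq =>
    hθ.twoPoint_zero hF hv hq α m

/-- The derivatives of `θ̂` are those of `θ` along the multiples of `∂_κ`. -/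
theorem IsCalibration.dirDeriv_legendreCalibration (hθ : F.IsCalibration v.source v ι μ R θ)
    (hF : F.IsFrobenius) (hv : F.IsFlatChart v) {p : M} (hp : p ∈ v.source) (α : Fin n) (m : ℕ)
    (X : TangentSpace 𝓘(ℂ, Fin n → ℂ) p) :
    dirDeriv (F.legendreCalibration v θ κ α m) p X =
      dirDeriv (θ α m) p (F.mul p (coordVec v p κ) X) := by
  have hinv := dCoord_chart_isInvertible hv.1 hp
  have h : F.legendreCalibration v θ κ α m =ᶠ[𝓝 p] coordDeriv v κ (θ α (m + 1)) := by
    filter_upwards [v.open_source.mem_nhds hp] with q hq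
    exact hθ.twoPoint_zero hF hv hq α m
  rw [dirDeriv_congr h, dirDeriv_eq_sum hinv, dirDeriv_eq_sum hinv (θ α m)]
  simp only [hθ.succ α m _ κ p hp, Finset.mul_sum]
  rw [Finset.sum_comm]
  refine Finset.sum_congr rfl fun σ _ => ?_
  rw [← mulMatrix_mulVec F hinv, Matrix.mulVec, dotProduct, Finset.sum_mul]
  refine Finset.sum_congr rfl fun β _ => ?_
  rw [mulMatrix, Matrix.of_apply, hF.mul_comm p (coordVec v p κ), cUp]
  ring

theorem IsCalibration.isHolomorphicOn_legendreCoord (hθ : F.IsCalibration v.source v ι μ R θ)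
    (hF : F.IsFrobenius) (hv : F.IsFlatChart v) (α : Fin n) :
    IsHolomorphicOn n v.source (fun q => F.legendreCoord v θ κ q α) := by
  intro p hp
  exact (ContMDiffOn.congr (IsHolomorphicOn.sum_const_mul Finset.univ
    (fun β => (F.gram v p)⁻¹ α β) fun β _ => hθ.isHolomorphicOn_legendreCalibration hF hv β 0)
    fun q hq => legendreCoord_eq hv hp hq α) p hp

/-- `dv̂ = dv ∘ (∂_κ ·)`. -/
theorem IsCalibration.dCoord_legendreCoord (hθ : F.IsCalibration v.source v ι μ R θ)
    (hF : F.IsFrobenius) (hv : F.IsFlatChart v) {p : M} (hp : p ∈ v.source)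
    (X : TangentSpace 𝓘(ℂ, Fin n → ℂ) p) :
    dCoord (F.legendreCoord v θ κ) p X = dCoord v p (F.mul p (coordVec v p κ) X) := by
  have hinv := dCoord_chart_isInvertible hv.1 hp
  ext α
  have h : (fun q => F.legendreCoord v θ κ q α) =ᶠ[𝓝 p]
      fun q => ∑ β, (F.gram v p)⁻¹ α β * F.legendreCalibration v θ κ β 0 q := by
    filter_upwards [v.open_source.mem_nhds hp] with q hq using legendreCoord_eq hv hp hq α
  rw [dCoord_apply fun i => (hθ.isHolomorphicOn_legendreCoord hF hv i).mdifferentiableAt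
    v.open_source hp, dirDeriv_congr h, dirDeriv_sum_const_mul _ _ fun β _ =>
    (hθ.isHolomorphicOn_legendreCalibration hF hv β 0).mdifferentiableAt v.open_source hp]
  simp only [hθ.dirDeriv_legendreCalibration hF hv hp, hθ.dirDeriv_zero hv hp]
  have h2 : Matrix.mulVec (F.gram v p)⁻¹ (Matrix.mulVec (F.gram v p)
      (dCoord v p (F.mul p (coordVec v p κ) X))) = dCoord v p (F.mul p (coordVec v p κ) X) := by
    rw [Matrix.mulVec_mulVec, Matrix.nonsing_inv_mul _ (hF.isUnit_det_gram hinv),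
      Matrix.one_mulVec]
  exact congrFun h2 α

theorem IsCalibration.legendreCoord_isInvertible (hθ : F.IsCalibration v.source v ι μ R θ)
    (hF : F.IsFrobenius) (hv : F.IsFlatChart v) {p : M} (hp : p ∈ v.source)
    (hκ : Function.Bijective (F.mul p (coordVec v p κ))) :
    (dCoord (F.legendreCoord v θ κ) p).IsInvertible := by
  refine dCoord_isInvertible_of_injective fun X Y h => ?_
  rw [hθ.dCoord_legendreCoord hF hv hp, hθ.dCoord_legendreCoord hF hv hp] at h
  exact hκ.1 (dCoord_injective (dCoord_chart_isInvertible hv.1 hp) h)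

/-- `∂_κ · ∂/∂v̂^α = ∂/∂v^α`. -/
theorem IsCalibration.mul_coordVec_legendreCoord (hθ : F.IsCalibration v.source v ι μ R θ)
    (hF : F.IsFrobenius) (hv : F.IsFlatChart v) {p : M} (hp : p ∈ v.source)
    (hκ : Function.Bijective (F.mul p (coordVec v p κ))) (α : Fin n) :
    F.mul p (coordVec v p κ) (coordVec (F.legendreCoord v θ κ) p α) = coordVec v p α := by
  have hinv := dCoord_chart_isInvertible hv.1 hp
  apply dCoord_injective hinv
  rw [← hθ.dCoord_legendreCoord hF hv hp,
    dCoord_coordVec (hθ.legendreCoord_isInvertible hF hv hp hκ), dCoord_coordVec hinv]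

theorem IsCalibration.gram_legendre (hθ : F.IsCalibration v.source v ι μ R θ)
    (hF : F.IsFrobenius) (hv : F.IsFlatChart v) {p : M} (hp : p ∈ v.source)
    (hκ : Function.Bijective (F.mul p (coordVec v p κ))) :
    (F.legendre v μ κ).gram (F.legendreCoord v θ κ) p = F.gram v p := by
  ext α β
  simp only [gram, Matrix.of_apply, legendre, LinearMap.compl₁₂_apply]
  rw [hθ.mul_coordVec_legendreCoord hF hv hp hκ, hθ.mul_coordVec_legendreCoord hF hv hp hκ]

/-- The change of frame is multiplication by `∂_κ`, which commutes with multiplication by `E`. -/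
theorem IsCalibration.eulerMul_legendre (hθ : F.IsCalibration v.source v ι μ R θ)
    (hF : F.IsFrobenius) (hv : F.IsFlatChart v) {p : M} (hp : p ∈ v.source)
    (hκ : Function.Bijective (F.mul p (coordVec v p κ))) :
    (F.legendre v μ κ).eulerMul (F.legendreCoord v θ κ) p = F.eulerMul v p := by
  ext α β
  rw [eulerMul_apply _ (hθ.legendreCoord_isInvertible hF hv hp hκ),
    eulerMul_apply F (dCoord_chart_isInvertible hv.1 hp), hθ.dCoord_legendreCoord hF hv hp]
  change dCoord v p (F.mul p _ (F.mul p (F.euler p) _)) α = _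
  rw [← hF.mul_assoc, hF.mul_comm p _ (F.euler p), hF.mul_assoc,
    hθ.mul_coordVec_legendreCoord hF hv hp hκ]

/-- The components of `E` in `v̂` are those of `∂_κ · E` in `v`, i.e. the column `𝓤^α_κ`. Its
derivative along `∂/∂v̂^β` is `(1 - μ_α + μ_κ) δ^α_β`, and the charge `-2 μ_κ` contributes `1 +
μ_κ`, leaving `μ_α` on the diagonal. -/
theorem IsCalibration.gradingMatrix_legendre (hθ : F.IsCalibration v.source v ι μ R θ)
    (hF : F.IsFrobenius) (hv : F.IsAdaptedFlatChart v ι μ r) {p : M} (hp : p ∈ v.source)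
    (hκ : Function.Bijective (F.mul p (coordVec v p κ))) :
    (F.legendre v μ κ).gradingMatrix (F.legendreCoord v θ κ) p = Matrix.diagonal μ := by
  have hinv := dCoord_chart_isInvertible hv.1.1 hp
  ext α β
  have h1 : (F.legendre v μ κ).eulerComp (F.legendreCoord v θ κ) α =ᶠ[𝓝 p]
      fun q => F.eulerMul v q α κ := by
    filter_upwards [v.open_source.mem_nhds hp] with q hq
    rw [eulerMul_apply F (dCoord_chart_isInvertible hv.1.1 hq), hF.mul_comm,
      ← hθ.dCoord_legendreCoord hF hv.1 hq]
    rfl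
  have h2 : coordDeriv (F.legendreCoord v θ κ) β
      ((F.legendre v μ κ).eulerComp (F.legendreCoord v θ κ) α) p =
      (1 - μ α + μ κ) * (Pi.single β 1 : Fin n → ℂ) α := by
    rw [coordDeriv, dirDeriv_congr h1, hF.dirDeriv_eulerMul hv hp,
      hθ.mul_coordVec_legendreCoord hF hv.1 hp hκ, dCoord_coordVec hinv]
  have h3 : (F.legendre v μ κ).charge = -2 * μ κ := rfl
  simp only [gradingMatrix, Matrix.sub_apply, Matrix.smul_apply, Matrix.of_apply, h2, h3, smul_eq_mul,
    Matrix.one_apply, Matrix.diagonal_apply, Pi.single_apply]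
  split_ifs
  · ring
  · ring

theorem IsCalibration.thetaMatrix_legendre (hθ : F.IsCalibration v.source v ι μ R θ)
    (hF : F.IsFrobenius) (hv : F.IsFlatChart v) {p : M} (hp : p ∈ v.source)
    (hκ : Function.Bijective (F.mul p (coordVec v p κ))) (z : ℂ) :
    (F.legendre v μ κ).thetaMatrix (F.legendreCoord v θ κ) (F.legendreCalibration v θ κ) p z =
      F.thetaMatrix v θ p z := by
  ext α β
  simp only [thetaMatrix, Matrix.of_apply, hθ.gram_legendre hF hv hp hκ, coordDeriv,
    hθ.dirDeriv_legendreCalibration hF hv hp, hθ.mul_coordVec_legendreCoord hF hv hp hκ]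

/-- The factor `du_i(∂_κ)` in the new root `ψ_{iκ}` is absorbed by the multiplicativity of `du_i`.
-/
theorem IsCalibration.transitionMatrix_legendre (hθ : F.IsCalibration v.source v ι μ R θ)
    (hF : F.IsFrobenius) (hv : F.IsAdaptedFlatChart v ι μ r) {u s : M → Fin n → ℂ}
    (hu : F.IsCanonicalCoordinates v.source v u) {p : M} (hp : p ∈ v.source)
    (hκ : Function.Bijective (F.mul p (coordVec v p κ))) :
    transitionMatrix (F.legendreCoord v θ κ) u (fun p i => transitionMatrix v u s p i κ) p =
      transitionMatrix v u s p := by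
  ext i α
  simp only [transitionMatrix, Matrix.of_apply]
  rw [_root_.mul_assoc, ← hu.dCoord_mul hF hv hp, hθ.mul_coordVec_legendreCoord hF hv.1 hp hκ]

theorem IsCalibration.isCanonicalCoordinates_legendre (hθ : F.IsCalibration v.source v ι μ R θ)
    (hF : F.IsFrobenius) (hv : F.IsFlatChart v) {u : M → Fin n → ℂ}
    (hu : F.IsCanonicalCoordinates v.source v u)
    (hκ : ∀ p ∈ v.source, Function.Bijective (F.mul p (coordVec v p κ))) :
    (F.legendre v μ κ).IsCanonicalCoordinates v.source (F.legendreCoord v θ κ) u where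
  holomorphic := hu.holomorphic
  eigenvalues p hp z := by
    rw [hθ.eulerMul_legendre hF hv hp (hκ p hp)]
    exact hu.eigenvalues p hp z
  distinct := hu.distinct

theorem IsRootChoice.legendre {u s : M → Fin n → ℂ} (hs : F.IsRootChoice v.source u s)
    (hF : F.IsFrobenius) (hv : F.IsAdaptedFlatChart v ι μ r)
    (hu : F.IsCanonicalCoordinates v.source v u) :
    (F.legendre v μ κ).IsRootChoice v.source u (fun p i => transitionMatrix v u s p i κ) := by
  constructor
  · intro i
    refine ContMDiffOn.congr ((hs.1 i).mul
      (IsHolomorphicOn.coordDeriv hv.1.1 (hu.holomorphic i) κ)) fun q hq => ?_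
    change s q i * dCoord u q (coordVec v q κ) i = _
    rw [dCoord_apply fun i =>
      (hu.holomorphic i).mdifferentiableAt v.open_source hq]
    rfl
  · intro p hp i
    have hinv := hu.dCoord_isInvertible hF hv hp
    -- Each `∂/∂u_i` is an eigenvector of `∂_κ ·`, so the new norm of `∂/∂u_i` is `du_i(∂_κ)²` times
    -- `η_{ii}`.
    have h : F.mul p (coordVec v p κ) (coordVec u p i) =
        dCoord u p (coordVec v p κ) i • coordVec u p i := by
      apply dCoord_injective hinv
      ext j
      rw [hu.dCoord_mul hF hv hp, map_smul, dCoord_coordVec hinv, Pi.smul_apply, Pi.single_apply,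
        smul_eq_mul]
      split_ifs with hij
      · rw [hij]
      · simp
    simp only [transitionMatrix, Matrix.of_apply, FrobeniusData.legendre, LinearMap.compl₁₂_apply]
    rw [h]
    simp only [map_smul, LinearMap.smul_apply, smul_eq_mul, mul_pow, hs.2 p hp i]
    ring

end FrobeniusData

end Legendre

/-! ### Invariance and uniqueness of the Stokes and central connection matrices. -/

section MonodromyData

variable {n : ℕ} {M : Type*} [TopologicalSpace M] [ChartedSpace (Fin n → ℂ) M]

namespace FrobeniusData

/-- The Frobenius structure, its flat coordinates and the roots enter the Stokes matrix only through
`V`. -/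
theorem IsStokesMatrix.congr {F F' : FrobeniusData n M} {B : Set M} {w w' u s s' : M → Fin n → ℂ}
    (hV : ∀ p ∈ B, F.vMatrix w u s p = F'.vMatrix w' u s' p) {φ : ℝ} {p : M} (hp : p ∈ B)
    {S : Matrix (Fin n) (Fin n) ℂ} (h : F.IsStokesMatrix B w u s φ p S) :
    F'.IsStokesMatrix B w' u s' φ p S := by
  obtain ⟨Φ, hΦ, ε, h0, h1, Yr, Yl, hr, hl, hS⟩ := h
  rw [hV p hp] at hr hl
  exact ⟨Φ, hΦ.congr hV, ε, h0, h1, Yr, Yl, hr, hl, hS⟩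

theorem IsCentralConnectionMatrix.congr {F F' : FrobeniusData n M} {B : Set M}
    {w w' u s s' : M → Fin n → ℂ} {θ θ' : Fin n → ℕ → M → ℂ} {μ : Fin n → ℂ}
    {R : Matrix (Fin n) (Fin n) ℂ}
    (hV : ∀ p ∈ B, F.vMatrix w u s p = F'.vMatrix w' u s' p) {φ : ℝ} {p : M} (hp : p ∈ B)
    (hY : ∀ ζ, F.solutionAtZero w u s θ μ R p ζ = F'.solutionAtZero w' u s' θ' μ R p ζ)
    {C : Matrix (Fin n) (Fin n) ℂ} (h : F.IsCentralConnectionMatrix B w u s θ μ R φ p C) :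
    F'.IsCentralConnectionMatrix B w' u s' θ' μ R φ p C := by
  obtain ⟨Φ, hΦ, ε, h0, h1, Yr, hr, hC⟩ := h
  rw [hV p hp] at hr
  refine ⟨Φ, hΦ.congr hV, ε, h0, h1, Yr, hr, fun r t h2 h3 h4 => ?_⟩
  rw [← hY]
  exact hC r t h2 h3 h4

variable {F : FrobeniusData n M} {B : Set M} {w u s : M → Fin n → ℂ} {φ : ℝ} {p : M}

/-- The Stokes matrix is unique. -/
theorem IsStokesMatrix.unique {S S' : Matrix (Fin n) (Fin n) ℂ} (hp : p ∈ B)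
    (hu : Function.Injective (u p)) (h : F.IsStokesMatrix B w u s φ p S)
    (h' : F.IsStokesMatrix B w u s φ p S') : S = S' := by
  obtain ⟨Φ, hΦ, ε, h0, -, Yr, Yl, hr, hl, hS⟩ := h
  obtain ⟨Φ', hΦ', ε', h0', -, Yr', Yl', hr', hl', hS'⟩ := h'
  have hΦe : (fun k => Φ' k p) = fun k => Φ k p :=
    funext fun k => (hΦ.unique hΦ' k hp hu).symm
  rw [hΦe] at hr' hl'
  have hΦ0 : (fun k => Φ k p) 0 = 1 := hΦ.zero p hp
  -- The two matrices may come with different `ε`. On the common sectors, of opening `π + 2δ`, the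
  -- sectorial solutions are unique, and one point of the overlap then compares the matrices.
  set δ := min ε ε' with hδ
  have hδ0 : 0 < δ := lt_min h0 h0'
  have hδ1 : δ ≤ ε := min_le_left _ _
  have hδ2 : δ ≤ ε' := min_le_right _ _
  have hpi := Real.pi_pos
  have hz : (1 : ℝ) * Complex.exp (φ * Complex.I) ∈ sector (φ - δ) (φ + δ) :=
    ⟨1, φ, one_pos, by linarith, by linarith, rfl⟩
  set z := ((1 : ℝ) : ℂ) * Complex.exp (φ * Complex.I)
  have e1 := IsSectorialSolution.unique (a := φ - Real.pi - δ) (b := φ + δ) (by linarith) hΦ0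
    (hr.mono (sector_mono (by linarith) (by linarith)))
    (hr'.mono (sector_mono (by linarith) (by linarith)))
    (sector_mono (by linarith) le_rfl hz)
  have e2 := IsSectorialSolution.unique (a := φ - δ) (b := φ + Real.pi + δ) (by linarith) hΦ0
    (hl.mono (sector_mono (by linarith) (by linarith)))
    (hl'.mono (sector_mono (by linarith) (by linarith)))
    (sector_mono le_rfl (by linarith) hz)
  have e3 := hS z (sector_mono (by linarith) (by linarith) hz)
  have e4 := hS' z (sector_mono (by linarith) (by linarith) hz)
  have hd := hr.nonsingular z (sector_mono (by linarith) (by linarith) hz)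
  rw [e2, e4, ← e1] at e3
  rw [← Matrix.nonsing_inv_mul_cancel_left (Yr z) S hd.isUnit, ← e3,
    Matrix.nonsing_inv_mul_cancel_left (Yr z) S' hd.isUnit]

/-- The central connection matrix is unique. -/
theorem IsCentralConnectionMatrix.unique {θ : Fin n → ℕ → M → ℂ} {μ : Fin n → ℂ}
    {R C C' : Matrix (Fin n) (Fin n) ℂ} (hp : p ∈ B) (hu : Function.Injective (u p))
    (h : F.IsCentralConnectionMatrix B w u s θ μ R φ p C)
    (h' : F.IsCentralConnectionMatrix B w u s θ μ R φ p C') : C = C' := by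
  obtain ⟨Φ, hΦ, ε, h0, -, Yr, hr, hC⟩ := h
  obtain ⟨Φ', hΦ', ε', h0', -, Yr', hr', hC'⟩ := h'
  have hΦe : (fun k => Φ' k p) = fun k => Φ k p :=
    funext fun k => (hΦ.unique hΦ' k hp hu).symm
  rw [hΦe] at hr'
  have hΦ0 : (fun k => Φ k p) 0 = 1 := hΦ.zero p hp
  set δ := min ε ε' with hδ
  have hδ0 : 0 < δ := lt_min h0 h0'
  have hδ1 : δ ≤ ε := min_le_left _ _
  have hδ2 : δ ≤ ε' := min_le_right _ _
  have hpi := Real.pi_pos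
  have hz : (1 : ℝ) * Complex.exp (φ * Complex.I) ∈ sector (φ - Real.pi - δ) (φ + δ) :=
    ⟨1, φ, one_pos, by linarith, by linarith, rfl⟩
  have e1 := IsSectorialSolution.unique (a := φ - Real.pi - δ) (b := φ + δ) (by linarith) hΦ0
    (hr.mono (sector_mono (by linarith) (by linarith)))
    (hr'.mono (sector_mono (by linarith) (by linarith))) hz
  have e3 := hC 1 φ one_pos (by linarith) (by linarith)
  have e4 := hC' 1 φ one_pos (by linarith) (by linarith)
  have hd := hr.nonsingular _ (sector_mono (by linarith) (by linarith) hz)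
  rw [← e1, e3] at e4
  -- The nonsingularity of `Y_0` at this point is read off from that of `Y_right = Y_0 C`.
  rw [e3, Matrix.det_mul] at hd
  have hd' := (left_ne_zero_of_mul hd).isUnit
  rw [← Matrix.nonsing_inv_mul_cancel_left _ C hd', e4,
    Matrix.nonsing_inv_mul_cancel_left _ C' hd']

end FrobeniusData

end MonodromyData

end

/-! ### Comparison of `M` with `S_κ(M)`. -/

theorem mainTheorem1 {n : ℕ} {M : Type*} [TopologicalSpace M] [ChartedSpace (Fin n → ℂ) M]
    [IsManifold 𝓘(ℂ, Fin n → ℂ) ω M]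
    -- a semisimple Frobenius manifold
    (F : FrobeniusData n M) (hF : F.IsFrobenius) (hss : F.IsSemisimple)
    -- a flat chart with coordinates `v` on `B`, with `e = ∂/∂v^ι`
    (v : OpenPartialHomeomorph M (Fin n → ℂ)) (B : Set M) (hB : B = v.source)
    (ι : Fin n) (μ r : Fin n → ℂ) (hv : F.IsAdaptedFlatChart v ι μ r)
    -- monodromy data at `z = 0` and a calibration
    (R : Matrix (Fin n) (Fin n) ℂ) (θ : Fin n → ℕ → M → ℂ) (hθ : F.IsCalibration B v ι μ R θ)
    -- canonical coordinates on `B` and a choice of the square roots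
    (u s : M → Fin n → ℂ) (hu : F.IsCanonicalCoordinates B v u) (hs : F.IsRootChoice B u s)
    -- multiplication by `∂/∂v^κ` is invertible on `B`
    (κ : Fin n) (hκ : ∀ p ∈ B, Function.Bijective (F.mul p (coordVec v p κ)))
    -- `S_κ(M)`, its flat coordinates, its calibration, and its square roots `ψ_{iκ}`
    (F' : FrobeniusData n M) (hF' : F' = F.legendre v μ κ)
    (v' : M → Fin n → ℂ) (hv' : v' = F.legendreCoord v θ κ)
    (θ' : Fin n → ℕ → M → ℂ) (hθ' : θ' = F.legendreCalibration v θ κ)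
    (s' : M → Fin n → ℂ) (hs' : s' = fun p i => transitionMatrix v u s p i κ) :
    -- `v'` are flat coordinates, `u` canonical coordinates, `s'` square roots for `S_κ(M)`
    (∀ p ∈ B, (dCoord v' p).IsInvertible ∧ F'.gram v' p = F.gram v p) ∧
    F'.IsCanonicalCoordinates B v' u ∧ F'.IsRootChoice B u s' ∧
    -- `Ψ = Ψ̂` and `V = V̂`
    (∀ p ∈ B, transitionMatrix v u s p = transitionMatrix v' u s' p) ∧
    (∀ p ∈ B, F.vMatrix v u s p = F'.vMatrix v' u s' p) ∧
    -- the formal solutions at `z = ∞` agree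
    (∀ Φ : ℕ → M → Matrix (Fin n) (Fin n) ℂ,
      IsFormalSolution B u (F.vMatrix v u s) Φ ↔ IsFormalSolution B u (F'.vMatrix v' u s') Φ) ∧
    (∀ Φ Φ' : ℕ → M → Matrix (Fin n) (Fin n) ℂ,
      IsFormalSolution B u (F.vMatrix v u s) Φ → IsFormalSolution B u (F'.vMatrix v' u s') Φ' →
        ∀ k, ∀ p ∈ B, Φ k p = Φ' k p) ∧
    -- the Stokes matrices and the central connection matrices agree
    ∀ p ∈ B, ∀ φ : ℝ, 0 ≤ φ → φ < 2 * Real.pi → IsAdmissible (u p) φ →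
      (∀ S, F.IsStokesMatrix B v u s φ p S ↔ F'.IsStokesMatrix B v' u s' φ p S) ∧
      (∀ S S', F.IsStokesMatrix B v u s φ p S → F'.IsStokesMatrix B v' u s' φ p S' → S = S') ∧
      (∀ C, F.IsCentralConnectionMatrix B v u s θ μ R φ p C ↔
        F'.IsCentralConnectionMatrix B v' u s' θ' μ R φ p C) ∧
      (∀ C C', F.IsCentralConnectionMatrix B v u s θ μ R φ p C →
        F'.IsCentralConnectionMatrix B v' u s' θ' μ R φ p C' → C = C') := by
  subst hB hF' hv' hθ' hs'
  have hu' := hθ.isCanonicalCoordinates_legendre (μ := μ) hF hv.1 hu hκ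
  have hΨ : ∀ p ∈ v.source, transitionMatrix v u s p = transitionMatrix (F.legendreCoord v θ κ) u
      (fun p i => transitionMatrix v u s p i κ) p := fun p hp =>
    (hθ.transitionMatrix_legendre hF hv hu hp (hκ p hp)).symm
  -- On both sides `V` is the same conjugate `Ψ diag(μ) Ψ⁻¹`.
  have hV : ∀ p ∈ v.source, F.vMatrix v u s p = (F.legendre v μ κ).vMatrix
      (F.legendreCoord v θ κ) u (fun p i => transitionMatrix v u s p i κ) p := fun p hp => by
    rw [FrobeniusData.vMatrix, FrobeniusData.vMatrix, ← hΨ p hp, hv.gradingMatrix_eq hp,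
      hθ.gradingMatrix_legendre hF hv hp (hκ p hp)]
  have hV' := fun p hp => (hV p hp).symm
  have hY : ∀ p ∈ v.source, ∀ ζ, F.solutionAtZero v u s θ μ R p ζ =
      (F.legendre v μ κ).solutionAtZero (F.legendreCoord v θ κ) u
        (fun p i => transitionMatrix v u s p i κ) (F.legendreCalibration v θ κ) μ R p ζ :=
    fun p hp ζ => by
      rw [FrobeniusData.solutionAtZero, FrobeniusData.solutionAtZero, ← hΨ p hp,
        hθ.thetaMatrix_legendre hF hv.1 hp (hκ p hp)]
  refine ⟨fun p hp => ⟨hθ.legendreCoord_isInvertible hF hv.1 hp (hκ p hp),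
    hθ.gram_legendre hF hv.1 hp (hκ p hp)⟩, hu', hs.legendre hF hv hu, hΨ, hV,
    fun Φ => ⟨fun h => h.congr hV, fun h => h.congr hV'⟩,
    fun Φ Φ' h h' k p hp => h.unique (h'.congr hV') k hp (hu.distinct p hp),
    fun p hp φ _ _ _ => ⟨fun S => ⟨fun h => h.congr hV hp, fun h => h.congr hV' hp⟩,
      fun S S' h h' => h.unique hp (hu.distinct p hp) (h'.congr hV' hp),
      fun C => ⟨fun h => h.congr hV hp (hY p hp), fun h => h.congr hV' hp fun ζ => (hY p hp ζ).symm⟩,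
      fun C C' h h' => h.unique hp (hu.distinct p hp)
        (h'.congr hV' hp fun ζ => (hY p hp ζ).symm)⟩⟩
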